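/- **Setting.** Let $e_{\pm1}=(\pm1,0)$, $e_{\pm2}=(0,\pm1)$, $e_{-j}=-e_j$, and let $\omega=(\omega(x,e_k))_{x\in\mathbb Z^2,\,k\in\{\pm1,\pm2\}}$ be a random environment whose probability vectors $\omega(x,\cdot)$ are i.i.d. under $\mathbb P$. Write $i\perp j$ if $e_i,e_j$ are orthogonal, and $Q_S=\max_{k\in S}\omega(0,e_k)$. Let $a>0$ and let $\beta_j$ and $\alpha_{ij}=\alpha_{ji}$ ($i\perp j$) be real numbers with $0\le\alpha_{ij}\le\min(\beta_i,\beta_j)$ that realize condition $(X)_a$, i.e. (with $0^{-s}=\infty$ for $s>0$ and $0^0=1$), for all $j$, all $l\perp j$ and all $i\perp j$: $$\mathbb E\big[Q_{\{k\ne -j\}}^{-\beta_j}\big]<\infty,\qquad \mathbb E\big[Q_{\{i,j\}}^{-\alpha_{ij}}\big]<\infty,$$ $$\mathbb E\Big[Q_{\{k\neq -l\}}^{-\beta_j}\,Q_{\{l,-j\}}^{-\alpha_{l,-j}};\ \omega(0,e_j)>\omega(0,e_k)\ \text{for all } k\notin\{j,-l\}\Big]<\infty,\qquad \mathbb E\big[Q_{\{i,j\}}^{-\alpha_{ij}}Q_{\{-i,j\}}^{-\alpha_{-i,j}}\big]<\infty,$$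 $$\beta_j+\beta_{-j}>a,\qquad \alpha_{ij}+\beta_{-i}+\beta_{-j}>a,\qquad \alpha_{1,2}+\alpha_{-1,2}+\alpha_{-1,-2}+\alpha_{1,-2}>a .$$ **Exploration.** Let $R\ge2$ be an integer, $B_R=\{|x|_\infty\le R\}$ and $\partial B_R=\{|x|_\infty=R\}$. Let $j_*=j_*(\omega)$ be any measurable choice of a direction maximizing $\omega(0,e_k)$, and $0'=e_{j_*}$. Two exploration processes are run. The first starts from the single active vertex $0$ with instruction "forward-$(-j_*)$", the second from the single active vertex $0'$ with instruction "forward-$j_*$". At each step the lexicographically smallest active vertex $x$ is treated, as follows (arg max ties other than in the choice of $j_*$ are broken by the smallest index). * If $x$ carries "forward-$j$" and $\omega(x,e_j)=\max_{k\ne-j}\omega(x,e_k)$, activate $x+e_j$ with "forward-$j$". * If $x$ carries "forward-$j$" and this fails (a *bifurcation*), let $k_1=\arg\max_{k\neq-j}\omega(x,e_k)$ and $k_2=\arg\max_{k\notin\{-j,k_1\}}\omega(x,e_k)$, and activate $x+e_{k_1}$ and $x+e_{k_2}$. Give $x+e_{k_2}$ the instruction "orthogonal-$(j,-k_1)$".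 Give $x+e_{k_1}$ the instruction "forward-$k_1$" if the number of previous bifurcations of this process is even, and "orthogonal-$(j,k_1)$" if it is odd. * If $x$ carries "orthogonal-$(i,j)$", activate $x+e_k$, $k=\arg\max_{k\in\{i,j\}}\omega(x,e_k)$, with "orthogonal-$(i,j)$". Then $x$ is deactivated, and newly reached vertices of $\partial B_R$ are deactivated at once. The process stops when no vertex is active. Let $\mathcal E_1,\mathcal E_2$ be the sets of directed edges $(x,x+e_k)$ along which the two processes activated vertices. **Capacity.** Process $i$ gives an edge $(x,x+e_k)\in\mathcal E_i$ the capacity $c_i$ defined as follows: $\beta_k$ if $x$ carried "forward-$k$" and no bifurcation took place at $x$; at a bifurcation of an instruction "forward-$l$", $\beta_{k_1}$ for $k=k_1$ and $\alpha_{l,-k_1}$ for $k=k_2$; $\alpha_{ij}$ if $x$ carried "orthogonal-$(i,j)$". Put $c_i=0$ off $\mathcal E_i$ and $c=\max(c_1,c_2)$. **Flows.** A flow with source $A$ and sink $Z$ is a nonnegative function $\theta$ on the directed nearest-neighbour edges whose divergence (outflow minus inflow) is $0$ off $A\cup Z$, $\ge0$ on $A$ and $\le0$ on $Z$; its strength is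 $\|\theta\|=\sum_{x\in A}\operatorname{div}\theta(x)$. **Theorem.** For every integer $R\ge2$ there exist $\varepsilon>0$ and a random function $\theta$ (with $\omega\mapsto\theta(\omega,e)$ measurable for each directed edge $e$) such that, $\mathbb P$-almost surely, $\theta(\omega,\cdot)$ is a flow with source $\{0,0'\}$ and sink $\partial B_R$, $$\|\theta(\omega,\cdot)\|\ \ge\ a+\varepsilon ,\qquad\text{and}\qquad \theta(\omega,e)\le c(\omega,e)\ \text{ for every directed edge } e .$$ -/

import Mathlib

open MeasureTheory ProbabilityTheory
open scoped ENNReal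

namespace RWRE

/-! ### Random environments on the square lattice -/

/-- Vertices of the square lattice. -/
abbrev Site : Type := ℤ × ℤ

/-- The four directions, listed in the order of their indices `-2 < -1 < 1 < 2`:
`0` stands for `e₋₂` (down), `1` for `e₋₁` (left), `2` for `e₁` (right), `3` for `e₂` (up).
Hence the order of `Fin 4` is the order of the indices and `Fin.rev` is the map `j ↦ -j`. -/
abbrev Dir : Type := Fin 4

/-- The unit vector `e_j`. -/
def step : Dir → Site := ![(0, -1), (-1, 0), (1, 0), (0, 1)]

/-- The directions `i` and `j` are orthogonal. -/
def Orth (i j : Dir) : Prop := j ≠ i ∧ j ≠ i.rev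

/-- All the directions except the one opposite to `j`. -/
def notBack (j : Dir) : Finset Dir := Finset.univ.erase j.rev

/-- An environment: a probability vector on the four directions at each site. -/
abbrev Env : Type := Site → stdSimplex ℝ Dir

/-- The random variables `ω(x)`, `x ∈ ℤ²`, are independent and identically distributed. -/
structure IsIID (μ : Measure Env) : Prop where
  indep : iIndepFun (fun (x : Site) (ω : Env) => ω x) μ
  ident : ∀ x : Site, IdentDistrib (fun ω : Env => ω x) (fun ω : Env => ω 0) μ μ

/-! ### The ellipticity condition -/

/-- `Q_S = max_{k ∈ S} ω(0, e_k)`, as an extended nonnegative number (so that negative powers of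
zero are infinite). -/
noncomputable def Q (S : Finset Dir) (ω : Env) : ℝ≥0∞ :=
  S.sup fun k => ENNReal.ofReal (ω 0 k)

/-- The event that `j` is the direction of the largest transition probability at the origin among
all directions except `-l`. -/
def argmaxEvent (l j : Dir) : Set Env :=
  {ω | ∀ k ∈ notBack l, k ≠ j → ω 0 k < ω 0 j}

/-- Condition `(X)_a` with the exponents `β j` and `α s(i, j)`.  The exponent `β j` belongs to the
three-direction diagram centred at `j` (all directions but `-j`), and `α s(i, j)`, for `i` and `j`
orthogonal, to the corner formed by `i` and `j`. -/
structure ConditionX (μ : Measure Env) (a : ℝ) (β : Dir → ℝ) (α : Sym2 Dir → ℝ) : Prop where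
  int_beta : ∀ j, ∫⁻ ω, Q (notBack j) ω ^ (-β j) ∂μ < ∞
  int_alpha : ∀ i j, Orth i j → ∫⁻ ω, Q {i, j} ω ^ (-α s(i, j)) ∂μ < ∞
  int_beta_alpha : ∀ l j, Orth l j →
    ∫⁻ ω in argmaxEvent l j,
      Q (notBack l) ω ^ (-β j) * Q {l, j.rev} ω ^ (-α s(l, j.rev)) ∂μ < ∞
  int_alpha_alpha : ∀ i j, Orth i j →
    ∫⁻ ω, Q {i, j} ω ^ (-α s(i, j)) * Q {i.rev, j} ω ^ (-α s(i.rev, j)) ∂μ < ∞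
  edge : ∀ j, a < β j + β j.rev
  wedge : ∀ i j, Orth i j → a < α s(i, j) + β i.rev + β j.rev
  square : a < α s(2, 3) + α s(1, 3) + α s(1, 0) + α s(2, 0)

/-! ### The exploration processes -/

/-- The instruction carried by an activated vertex. -/
inductive Instruction : Type
  | forward (j : Dir)
  | orthogonal (i j : Dir)

/-- `argmax_{k ∈ S} p k`, the smallest index being taken in case of a tie. -/
noncomputable def best (p : Dir → ℝ) (S : Finset Dir) : Dir :=
  ((S.filter fun k => ∀ l ∈ S, p l ≤ p k).min).untopD 0

/-- The forward move in direction `j` is allowed: `j ∈ argmax_{k ≠ -j} p k`. -/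
def CanForward (p : Dir → ℝ) (j : Dir) : Prop := ∀ k ∈ notBack j, p k ≤ p j

/-- The first direction chosen by a bifurcation of direction `j`. -/
noncomputable def bif₁ (p : Dir → ℝ) (j : Dir) : Dir := best p (notBack j)

/-- The second direction chosen by a bifurcation of direction `j`. -/
noncomputable def bif₂ (p : Dir → ℝ) (j : Dir) : Dir := best p ((notBack j).erase (bif₁ p j))

open Classical in
/-- The activation rules: the directions of the neighbours activated from a vertex with transition
probabilities `p`, each with the instruction handed over to that neighbour, when `b` bifurcations
have been performed before. -/
noncomputable def activate (p : Dir → ℝ) (b : ℕ) : Instruction → List (Dir × Instruction)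
  | .forward j =>
      if CanForward p j then [(j, .forward j)]
      else if b % 2 = 0 then
        [(bif₁ p j, .forward (bif₁ p j)), (bif₂ p j, .orthogonal j (bif₁ p j).rev)]
      else
        [(bif₁ p j, .orthogonal j (bif₁ p j)), (bif₂ p j, .orthogonal j (bif₁ p j).rev)]
  | .orthogonal i j => [(best p {i, j}, .orthogonal i j)]

open Classical in
/-- The number of bifurcations (`0` or `1`) performed by an instruction. -/
noncomputable def bifCount (p : Dir → ℝ) : Instruction → ℕ
  | .forward j => if CanForward p j then 0 else 1
  | .orthogonal _ _ => 0

/-- The boundary of the box `B_R = {x : |x|_∞ ≤ R}`. -/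
def boundary (R : ℕ) : Set Site := {x | max x.1.natAbs x.2.natAbs = R}

/-- State of an exploration process.  Besides the activated vertices, the deactivated vertices and
the number of bifurcations, it records the instruction of each vertex (only meaningful at vertices
activated so far) and the directed edges `(x, x + e_j)` along which vertices were activated. -/
structure State : Type where
  active : Finset Site
  deactivated : Finset Site
  bifurcations : ℕ
  instr : Site → Instruction
  edges : Finset (Site × Dir)

/-- The smallest site of a nonempty finite set in the lexicographic order. -/
noncomputable def lexMin (A : Finset Site) (h : A.Nonempty) : Site :=
  ofLex ((A.image toLex).min' (h.image _))

open Classical in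
/-- One update of an exploration process in the box `B_R`, performed at the smallest activated
site; nothing happens when there is no activated site. -/
noncomputable def update (R : ℕ) (ω : Env) (s : State) : State :=
  if h : s.active.Nonempty then
    let x := lexMin s.active h
    let new := activate (ω x) s.bifurcations (s.instr x)
    let newSites : Finset Site := (new.map fun c => x + step c.1).toFinset
    { active := newSites.filter (fun y => y ∉ boundary R) ∪ s.active.erase x
      deactivated := {x} ∪ newSites.filter (fun y => y ∈ boundary R) ∪ s.deactivated
      bifurcations := s.bifurcations + bifCount (ω x) (s.instr x)
      instr := new.foldl (fun f c => Function.update f (x + step c.1) c.2) s.instr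
      edges := (new.map fun c => (x, c.1)).toFinset ∪ s.edges }
  else s

/-- Initial state: one activated vertex `x₀`, carrying the instruction forward-`j`. -/
def initial (x₀ : Site) (j : Dir) : State where
  active := {x₀}
  deactivated := ∅
  bifurcations := 0
  instr := fun _ => .forward j
  edges := ∅

/-- The exploration process at time `t`. -/
noncomputable def explore (R : ℕ) (ω : Env) (x₀ : Site) (j : Dir) (t : ℕ) : State :=
  (update R ω)^[t] (initial x₀ j)

/-- The first time at which no vertex is activated. -/
noncomputable def stopTime (R : ℕ) (ω : Env) (x₀ : Site) (j : Dir) : ℕ :=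
  sInf {t | (explore R ω x₀ j t).active = ∅}

/-- The component generated by an exploration process: its state when it stops. -/
noncomputable def component (R : ℕ) (ω : Env) (x₀ : Site) (j : Dir) : State :=
  explore R ω x₀ j (stopTime R ω x₀ j)

/-! ### The random capacities -/

open Classical in
/-- Capacity of an edge of direction `k` leaving a vertex that has transition probabilities `p` and
carries the given instruction.  At a bifurcation of direction `l`, the edge in the direction `k₁` of
largest probability gets `β k₁`, and the other one, which was selected among the directions `l` and
`-k₁`, gets the exponent of the corner formed by `l` and `-k₁`. -/
noncomputable def edgeCapacity (β : Dir → ℝ) (α : Sym2 Dir → ℝ) (p : Dir → ℝ) (k : Dir) :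
    Instruction → ℝ
  | .forward l =>
      if CanForward p l then β l
      else if k = bif₁ p l then β k
      else α s(l, (bif₁ p l).rev)
  | .orthogonal i j => α s(i, j)

open Classical in
/-- Capacity of the directed edge `(x, x + e_k)` given by one component; it is zero if the edge does
not belong to the component. -/
noncomputable def componentCapacity (β : Dir → ℝ) (α : Sym2 Dir → ℝ) (ω : Env) (C : State)
    (x : Site) (k : Dir) : ℝ :=
  if (x, k) ∈ C.edges then edgeCapacity β α (ω x) k (C.instr x) else 0

/-- The capacity of the directed edge `(x, x + e_k)` in the environment `ω`, where `j` is the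
direction from `0` to `0'`: the first exploration starts at `0` with instruction forward-`(-j)`, the
second one at `0' = e_j` with instruction forward-`j`; an edge of both components gets the larger of
its two capacities, and an edge of neither of them gets zero. -/
noncomputable def capacity (β : Dir → ℝ) (α : Sym2 Dir → ℝ) (R : ℕ) (ω : Env) (j : Dir)
    (x : Site) (k : Dir) : ℝ :=
  max (componentCapacity β α ω (component R ω 0 j.rev) x k)
    (componentCapacity β α ω (component R ω (step j) j) x k)

/-! ### Flows on the directed square lattice -/

/-- Divergence at `x` of a function on directed nearest neighbour edges; `θ x k` is the value at the
edge from `x` to `x + e_k`. -/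
def divergence (θ : Site → Dir → ℝ) (x : Site) : ℝ :=
  ∑ k, θ x k - ∑ k, θ (x - step k) k

/-- `θ` is a flow with source `A` and sink `Z`. -/
structure IsFlow (θ : Site → Dir → ℝ) (A Z : Set Site) : Prop where
  nonneg : ∀ x k, 0 ≤ θ x k
  div_eq_zero : ∀ x, x ∉ A ∪ Z → divergence θ x = 0
  div_source : ∀ x ∈ A, 0 ≤ divergence θ x
  div_sink : ∀ x ∈ Z, divergence θ x ≤ 0

/-- The strength of a flow with finite source `A`. -/
def strength (θ : Site → Dir → ℝ) (A : Finset Site) : ℝ := ∑ x ∈ A, divergence θ x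

end RWRE

/-! The flow is built for each environment separately. Each exploration draws a tree of rigid shape:
a segment in its initial direction `d`, a stem in a direction `k` orthogonal to `d` after the first
bifurcation, and directed paths confined to the corners `{d, -k}`, `{k, d}` and `{k, -d}`. The
instruction of a site is a function of its position alone (`TreeData.isLabelling`), so the order of
treatment and repeated activations do not matter, and the process can be replaced by a set of sites
closed under the rules (`IsLabelling.exists_visited`). The tree contains three paths to the
boundary, one per corner; all share the segment, the last two also the stem
(`TreeData.exists_branches`). Weights on them are admissible once they respect `β d` on the segment,
`β k` on the stem and an `α` in each corner (`Branches.le_capacity`).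

The two trees start at adjacent sites in opposite directions. Three paths of one tree are combined
with two of the other, leaving out the path of the latter that may bend back. Capacities combine by
a maximum, so overlaps cost something, but these five paths overlap only in one corner `{-d, k}`,
which adds a single constraint. What remains is a linear programme in five weights; its value
reaches the minimum of an edge sum, a wedge sum and the square sum (`exists_weights`), provided that
the tree contributing three paths is well chosen (`exists_flow`). All these sums exceed `a`, and `ε`
is the smallest excess.

For measurability, the explorations see the environment only through comparisons of probabilities,
so the capacities take countably many values on measurable sets; the flow is chosen as a function of
`j_*` and the capacities. -/

namespace RWRE

/-! ### Coordinates along a direction -/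

/-- The coordinate of a site along the direction `k`. -/
def coord (k : Dir) (v : Site) : ℤ := v.1 * (step k).1 + v.2 * (step k).2

/-- The box `B_R`. -/
def InBox (R : ℕ) (v : Site) : Prop := max v.1.natAbs v.2.natAbs ≤ R

theorem Orth.symm {i j : Dir} (h : Orth i j) : Orth j i := by
  revert h; unfold Orth; revert i j; decide

theorem Orth.rev_right {i j : Dir} (h : Orth i j) : Orth i j.rev := by
  revert h; unfold Orth; revert i j; decide

theorem Orth.rev_left {i j : Dir} (h : Orth i j) : Orth i.rev j := by
  revert h; unfold Orth; revert i j; decide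

theorem Orth.eq_or_eq_rev {d k l : Dir} (h : Orth d k) (h' : Orth d l) : l = k ∨ l = k.rev := by
  revert h h'; unfold Orth; revert d k l; decide

theorem exists_orth (d : Dir) : ∃ k, Orth d k := by
  unfold Orth; revert d; decide

theorem step_rev (k : Dir) : step k.rev = -step k := by
  fin_cases k <;> rfl

theorem coord_add (k : Dir) (v w : Site) : coord k (v + w) = coord k v + coord k w := by
  simp only [coord, Prod.fst_add, Prod.snd_add]; ring

theorem coord_rev (k : Dir) (v : Site) : coord k.rev v = -coord k v := by
  simp only [coord, step_rev, Prod.fst_neg, Prod.snd_neg]; ring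

theorem coord_step_self (k : Dir) : coord k (step k) = 1 := by
  fin_cases k <;> rfl

theorem coord_step_rev (k : Dir) : coord k (step k.rev) = -1 := by
  fin_cases k <;> rfl

theorem Orth.coord_step {d k : Dir} (h : Orth d k) : coord d (step k) = 0 := by
  revert h; unfold Orth; revert d k; decide

theorem Orth.coord_ext {d k : Dir} (h : Orth d k) {v w : Site} (h₁ : coord d v = coord d w)
    (h₂ : coord k v = coord k w) : v = w := by
  obtain ⟨a, b⟩ := v
  obtain ⟨a', b'⟩ := w
  unfold Orth at h
  fin_cases d <;> fin_cases k <;> simp [coord, step] at h h₁ h₂ ⊢ <;> omega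

theorem Orth.inBox_iff {d k : Dir} (h : Orth d k) (R : ℕ) (v : Site) :
    InBox R v ↔ (-(R : ℤ) ≤ coord d v ∧ coord d v ≤ R) ∧ -(R : ℤ) ≤ coord k v ∧ coord k v ≤ R := by
  obtain ⟨a, b⟩ := v
  unfold Orth at h
  fin_cases d <;> fin_cases k <;> simp [coord, step, InBox] at h ⊢ <;> omega

theorem Orth.boundary_iff {d k : Dir} (h : Orth d k) {R : ℕ} {v : Site} (hv : InBox R v) :
    v ∈ boundary R ↔ coord d v = R ∨ coord d v = -R ∨ coord k v = R ∨ coord k v = -R := by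
  obtain ⟨a, b⟩ := v
  unfold Orth at h
  fin_cases d <;> fin_cases k <;> simp [coord, step, InBox, boundary] at h hv ⊢ <;> omega

theorem InBox.add_step {R : ℕ} {v : Site} (hv : InBox R v) (hb : v ∉ boundary R) (k : Dir) :
    InBox R (v + step k) := by
  obtain ⟨a, b⟩ := v
  fin_cases k <;> simp [step, InBox, boundary] at hv hb ⊢ <;> omega

/-! ### The directions chosen by the rules -/

theorem best_mem (p : Dir → ℝ) {S : Finset Dir} (hS : S.Nonempty) : best p S ∈ S := by
  obtain ⟨m, hm, hmax⟩ := S.exists_max_image p hS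
  have hne : (S.filter fun k => ∀ l ∈ S, p l ≤ p k).Nonempty :=
    ⟨m, Finset.mem_filter.2 ⟨hm, hmax⟩⟩
  obtain ⟨x, hx⟩ := Finset.min_of_nonempty hne
  have := Finset.mem_of_min hx
  simp only [best, hx]
  exact (Finset.mem_filter.1 this).1

theorem best_max (p : Dir → ℝ) {S : Finset Dir} (hS : S.Nonempty) : ∀ l ∈ S, p l ≤ p (best p S) := by
  obtain ⟨m, hm, hmax⟩ := S.exists_max_image p hS
  have hne : (S.filter fun k => ∀ l ∈ S, p l ≤ p k).Nonempty :=
    ⟨m, Finset.mem_filter.2 ⟨hm, hmax⟩⟩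
  obtain ⟨x, hx⟩ := Finset.min_of_nonempty hne
  have := Finset.mem_of_min hx
  simp only [best, hx]
  exact (Finset.mem_filter.1 this).2

theorem best_pair (p : Dir → ℝ) (i j : Dir) : best p {i, j} = i ∨ best p {i, j} = j := by
  simpa using best_mem p (S := {i, j}) (by simp)

theorem self_mem_notBack (j : Dir) : j ∈ notBack j := by
  revert j; unfold notBack; decide

/-- A first choice equal to `j` would make `j` a maximizer, so that the forward move would be
allowed; `-j` is never a candidate. -/
theorem orth_bif₁ {p : Dir → ℝ} {j : Dir} (h : ¬ CanForward p j) : Orth j (bif₁ p j) := by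
  have hne : (notBack j).Nonempty := ⟨j, self_mem_notBack j⟩
  refine ⟨fun he => h ?_, ?_⟩
  · intro k hk
    have := best_max p hne k hk
    rwa [show best p (notBack j) = j from he] at this
  · have := best_mem p hne
    exact (Finset.mem_erase.1 this).1

theorem bif₂_eq {p : Dir → ℝ} {j : Dir} (h : ¬ CanForward p j) :
    bif₂ p j = j ∨ bif₂ p j = (bif₁ p j).rev := by
  have ho := orth_bif₁ h
  have key : ∀ j k : Dir, (j ≠ k.rev → k ≠ j → k ≠ j.rev →
      (notBack j).erase k = {j, k.rev}) := by unfold notBack; decide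
  have he : (notBack j).erase (bif₁ p j) = {j, (bif₁ p j).rev} :=
    key j _ (fun e => ho.2 (Fin.rev_eq_iff.1 e.symm)) ho.1 ho.2
  unfold bif₂
  rw [he]
  exact best_pair p _ _

/-! ### Labellings that describe the course of an exploration -/

/-- The instruction is a forward one. -/
def Instruction.IsForward : Instruction → Prop
  | .forward _ => True
  | .orthogonal _ _ => False

/-- A labelling of a set `S` of sites by instructions `L` and numbers of previous bifurcations `σ`
that is compatible with the activation rules; `κ` decreases along the activations. -/
structure IsLabelling (R : ℕ) (ω : Env) (x₀ : Site) (j : Dir) (S : Site → Prop)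
    (L : Site → Instruction) (σ κ : Site → ℕ) : Prop where
  start_mem : S x₀
  start_not_boundary : x₀ ∉ boundary R
  start_label : L x₀ = .forward j
  start_stage : σ x₀ = 0
  closed : ∀ v, S v → v ∉ boundary R → ∀ c ∈ activate (ω v) (σ v) (L v),
    S (v + step c.1) ∧ L (v + step c.1) = c.2 ∧ κ (v + step c.1) < κ v ∧
      (c.2.IsForward → σ (v + step c.1) = σ v + bifCount (ω v) (L v))

/-- The invariant of an exploration that follows a labelling. -/
structure Follows (R : ℕ) (ω : Env) (x₀ : Site) (S : Site → Prop)
    (L : Site → Instruction) (σ : Site → ℕ) (s : State) : Prop where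
  label : ∀ v ∈ s.active ∪ s.deactivated, S v ∧ s.instr v = L v
  inner : ∀ v ∈ s.active, v ∉ boundary R
  forward_unique : ∀ v ∈ s.active, ∀ w ∈ s.active, (L v).IsForward → (L w).IsForward → v = w
  stage : ∀ v ∈ s.active, (L v).IsForward → s.bifurcations = σ v
  treated : ∀ v ∈ s.deactivated, v ∉ boundary R → ∀ c ∈ activate (ω v) (σ v) (L v),
    (v, c.1) ∈ s.edges ∧ v + step c.1 ∈ s.active ∪ s.deactivated
  start : x₀ ∈ s.active ∪ s.deactivated
  source : ∀ e ∈ s.edges, e.1 ∈ s.active ∪ s.deactivated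

/-- Overwriting is harmless because every instruction written is the one prescribed by `L`. -/
theorem foldl_update_eq (L : Site → Instruction) (x : Site) (l : List (Dir × Instruction))
    (h : ∀ c ∈ l, L (x + step c.1) = c.2) (f : Site → Instruction) (y : Site) :
    (y ∈ l.map (fun c => x + step c.1) ∨ f y = L y) →
      l.foldl (fun f c => Function.update f (x + step c.1) c.2) f y = L y := by
  induction l generalizing f with
  | nil => simp
  | cons c l ih =>
    intro hy
    simp only [List.foldl_cons]
    apply ih (fun c hc => h c (List.mem_cons_of_mem _ hc))
    by_cases hyc : y = x + step c.1
    · right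
      rw [hyc, Function.update_self, h c List.mem_cons_self]
    · rcases hy with hy | hy
      · simp only [List.map_cons, List.mem_cons] at hy
        exact Or.inl (hy.resolve_left hyc)
      · right
        rw [Function.update_of_ne hyc, hy]

theorem activate_of_canForward {p : Dir → ℝ} {j : Dir} (h : CanForward p j) (b : ℕ) :
    activate p b (.forward j) = [(j, .forward j)] :=
  if_pos h

theorem activate_of_even {p : Dir → ℝ} {j : Dir} (h : ¬ CanForward p j) {b : ℕ}
    (hb : b % 2 = 0) : activate p b (.forward j) =
      [(bif₁ p j, .forward (bif₁ p j)), (bif₂ p j, .orthogonal j (bif₁ p j).rev)] :=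
  (if_neg h).trans (if_pos hb)

theorem activate_of_odd {p : Dir → ℝ} {j : Dir} (h : ¬ CanForward p j) {b : ℕ}
    (hb : ¬ b % 2 = 0) : activate p b (.forward j) =
      [(bif₁ p j, .orthogonal j (bif₁ p j)), (bif₂ p j, .orthogonal j (bif₁ p j).rev)] :=
  (if_neg h).trans (if_neg hb)

theorem activate_orthogonal_stage {p : Dir → ℝ} {I : Instruction} (hI : ¬ I.IsForward) (b b' : ℕ) :
    activate p b I = activate p b' I := by
  cases I with
  | forward j => exact absurd trivial hI
  | orthogonal i j => rfl

theorem activate_orthogonal_snd {p : Dir → ℝ} {b : ℕ} {I : Instruction} (hI : ¬ I.IsForward)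
    {c : Dir × Instruction} (hc : c ∈ activate p b I) : ¬ c.2.IsForward := by
  cases I with
  | forward j => exact absurd trivial hI
  | orthogonal i j =>
    simp only [activate, List.mem_singleton] at hc
    subst hc
    exact id

theorem bifCount_orthogonal {p : Dir → ℝ} {I : Instruction} (hI : ¬ I.IsForward) :
    bifCount p I = 0 := by
  cases I with
  | forward j => exact absurd trivial hI
  | orthogonal i j => rfl

/-- This keeps at most one forward site active, so the global bifurcation counter can be read off
from a position. -/
theorem activate_forward_unique {p : Dir → ℝ} {b : ℕ} {I : Instruction} {c c' : Dir × Instruction}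
    (hc : c ∈ activate p b I) (hc' : c' ∈ activate p b I) (h : c.2.IsForward)
    (h' : c'.2.IsForward) : c = c' := by
  cases I with
  | forward j =>
    by_cases hf : CanForward p j
    · simp only [activate_of_canForward hf, List.mem_singleton] at hc hc'
      rw [hc, hc']
    by_cases hb : b % 2 = 0
    · simp only [activate_of_even hf hb, List.mem_cons, List.not_mem_nil, or_false] at hc hc'
      rcases hc with rfl | rfl
      · rcases hc' with rfl | rfl
        · rfl
        · exact h'.elim
      · exact h.elim
    · simp only [activate_of_odd hf hb, List.mem_cons, List.not_mem_nil, or_false] at hc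
      rcases hc with rfl | rfl <;> exact h.elim
  | orthogonal i j => exact absurd h (activate_orthogonal_snd (by exact id) hc)

theorem activate_length_le (p : Dir → ℝ) (b : ℕ) (I : Instruction) :
    (activate p b I).length ≤ 2 := by
  cases I with
  | forward j =>
    by_cases hf : CanForward p j
    · simp [activate_of_canForward hf]
    by_cases hb : b % 2 = 0
    · simp [activate_of_even hf hb]
    · simp [activate_of_odd hf hb]
  | orthogonal i j => simp [activate]

theorem lexMin_mem (A : Finset Site) (h : A.Nonempty) : lexMin A h ∈ A := by
  have := Finset.min'_mem (A.image toLex) (h.image _)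
  obtain ⟨x, hx, hxe⟩ := Finset.mem_image.1 this
  unfold lexMin
  rw [← hxe]
  exact hx

/-- A site activated again, even after its deactivation, receives the same instruction by `closed`.
Only forward sites consult or change the bifurcation counter, and at most one of them is active, so
the counter agrees with `σ` there. -/
theorem IsLabelling.follows_update {R : ℕ} {ω : Env} {x₀ : Site} {j : Dir} {S : Site → Prop}
    {L : Site → Instruction} {σ κ : Site → ℕ} (hL : IsLabelling R ω x₀ j S L σ κ) {s : State}
    (hs : Follows R ω x₀ S L σ s) : Follows R ω x₀ S L σ (update R ω s) := by
  classical
  by_cases hne : s.active.Nonempty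
  swap
  · unfold update; rw [dif_neg hne]; exact hs
  have hx := lexMin_mem s.active hne
  unfold update
  rw [dif_pos hne]
  set x := lexMin s.active hne
  have hxv : x ∈ s.active ∪ s.deactivated := Finset.mem_union_left _ hx
  obtain ⟨hxS, hxL⟩ := hs.label x hxv
  have hxb := hs.inner x hx
  have hact : activate (ω x) s.bifurcations (s.instr x) = activate (ω x) (σ x) (L x) := by
    rw [hxL]
    by_cases hf : (L x).IsForward
    · rw [hs.stage x hx hf]
    · exact activate_orthogonal_stage hf _ _
  have hA := hL.closed x hxS hxb
  dsimp only
  rw [hact, hxL]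
  set new := activate (ω x) (σ x) (L x) with hnew
  have hvis : ∀ v, v ∈ s.active ∪ s.deactivated ∨ v ∈ new.map (fun c => x + step c.1) →
      v ∈ ((new.map fun c => x + step c.1).toFinset.filter (fun y => y ∉ boundary R) ∪
          s.active.erase x) ∪
        ({x} ∪ (new.map fun c => x + step c.1).toFinset.filter (fun y => y ∈ boundary R) ∪
          s.deactivated) := by
    intro v hv
    simp only [Finset.mem_union, Finset.mem_filter, List.mem_toFinset, Finset.mem_erase,
      Finset.mem_singleton] at hv ⊢
    tauto
  have hactive : ∀ v, v ∈ (new.map fun c => x + step c.1).toFinset.filter (fun y => y ∉ boundary R) ∪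
      s.active.erase x → (∃ c ∈ new, x + step c.1 = v) ∨ (v ∈ s.active ∧ v ≠ x) := by
    intro v hv
    simp only [Finset.mem_union, Finset.mem_filter, List.mem_toFinset, Finset.mem_erase,
      List.mem_map] at hv
    exact hv.imp And.left And.symm
  have hnewfwd : ∀ c ∈ new, (L (x + step c.1)).IsForward → (L x).IsForward ∧ c.2.IsForward := by
    intro c hc hf
    rw [(hA c hc).2.1] at hf
    refine ⟨?_, hf⟩
    by_contra hn
    exact activate_orthogonal_snd hn hc hf
  refine ⟨?_, ?_, ?_, ?_, ?_, ?_, ?_⟩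
  · intro v hv
    have hv' : v ∈ s.active ∪ s.deactivated ∨ v ∈ new.map (fun c => x + step c.1) := by
      simp only [Finset.mem_union, Finset.mem_filter, List.mem_toFinset, Finset.mem_erase,
        Finset.mem_singleton] at hv ⊢
      rcases hv with (h | h) | ((h | h) | h)
      · exact Or.inr h.1
      · exact Or.inl (Or.inl h.2)
      · exact Or.inl (Or.inl (h ▸ hx))
      · exact Or.inr h.1
      · exact Or.inl (Or.inr h)
    refine ⟨?_, ?_⟩
    · rcases hv' with h | h
      · exact (hs.label v h).1
      · obtain ⟨c, hc, rfl⟩ := List.mem_map.1 h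
        exact (hA c hc).1
    · refine foldl_update_eq L x new (fun c hc => (hA c hc).2.1) s.instr v ?_
      rcases hv' with h | h
      · exact Or.inr (hs.label v h).2
      · exact Or.inl h
  · intro v hv
    simp only [Finset.mem_union, Finset.mem_filter, Finset.mem_erase] at hv
    rcases hv with h | h
    · exact h.2
    · exact hs.inner v h.2
  · intro v hv w hw hfv hfw
    rcases hactive v hv with ⟨c, hc, rfl⟩ | ⟨hv, hvx⟩ <;>
      rcases hactive w hw with ⟨c', hc', rfl⟩ | ⟨hw, hwx⟩
    · rw [activate_forward_unique hc hc' (hnewfwd c hc hfv).2 (hnewfwd c' hc' hfw).2]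
    · exact absurd (hs.forward_unique w hw x hx hfw (hnewfwd c hc hfv).1) hwx
    · exact absurd (hs.forward_unique v hv x hx hfv (hnewfwd c' hc' hfw).1) hvx
    · exact hs.forward_unique v hv w hw hfv hfw
  · intro v hv hfv
    rcases hactive v hv with ⟨c, hc, rfl⟩ | ⟨hv, hvx⟩
    · obtain ⟨h1, h2⟩ := hnewfwd c hc hfv
      rw [(hA c hc).2.2.2 h2, ← hs.stage x hx h1]
    · have : ¬ (L x).IsForward := fun h => hvx (hs.forward_unique v hv x hx hfv h)
      simp only [bifCount_orthogonal this, add_zero]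
      exact hs.stage v hv hfv
  · intro v hv hvb c hc
    simp only [Finset.mem_union, Finset.mem_filter, Finset.mem_singleton] at hv
    rcases hv with (h | h) | h
    · rw [h] at hc ⊢
      refine ⟨?_, hvis _ (Or.inr (List.mem_map_of_mem hc))⟩
      refine Finset.mem_union_left _ ?_
      rw [List.mem_toFinset, List.mem_map]
      exact ⟨c, hc, rfl⟩
    · exact absurd h.2 hvb
    · obtain ⟨h1, h2⟩ := hs.treated v h hvb c hc
      exact ⟨Finset.mem_union_right _ h1, hvis _ (Or.inl h2)⟩
  · exact hvis _ (Or.inl hs.start)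
  · intro e he
    rcases Finset.mem_union.1 he with h | h
    · obtain ⟨c, hc, rfl⟩ := List.mem_map.1 (List.mem_toFinset.1 h)
      exact hvis _ (Or.inl hxv)
    · exact hvis _ (Or.inl (hs.source e h))

theorem IsLabelling.follows_explore {R : ℕ} {ω : Env} {x₀ : Site} {j : Dir} {S : Site → Prop}
    {L : Site → Instruction} {σ κ : Site → ℕ} (hL : IsLabelling R ω x₀ j S L σ κ) (t : ℕ) :
    Follows R ω x₀ S L σ (explore R ω x₀ j t) := by
  induction t with
  | zero =>
    refine ⟨?_, ?_, ?_, ?_, ?_, ?_, ?_⟩ <;> simp [explore, initial, hL.start_mem, hL.start_label,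
      hL.start_not_boundary, hL.start_stage]
  | succ t ih =>
    unfold explore at ih ⊢
    rw [Function.iterate_succ_apply']
    exact hL.follows_update ih

/-- The potential that decreases at each update. -/
def potential (κ : Site → ℕ) (s : State) : ℕ := ∑ v ∈ s.active, 3 ^ κ v

/-- The treated site is replaced by at most two sites of smaller rank, and `2 * 3 ^ (r - 1) < 3 ^
r`. -/
theorem IsLabelling.potential_update_lt {R : ℕ} {ω : Env} {x₀ : Site} {j : Dir} {S : Site → Prop}
    {L : Site → Instruction} {σ κ : Site → ℕ} (hL : IsLabelling R ω x₀ j S L σ κ) {s : State}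
    (hs : Follows R ω x₀ S L σ s) (hne : s.active.Nonempty) :
    potential κ (update R ω s) < potential κ s := by
  classical
  have hx := lexMin_mem s.active hne
  unfold update
  rw [dif_pos hne]
  set x := lexMin s.active hne
  have hxv : x ∈ s.active ∪ s.deactivated := Finset.mem_union_left _ hx
  obtain ⟨hxS, hxL⟩ := hs.label x hxv
  have hxb := hs.inner x hx
  have hact : activate (ω x) s.bifurcations (s.instr x) = activate (ω x) (σ x) (L x) := by
    rw [hxL]
    by_cases hf : (L x).IsForward
    · rw [hs.stage x hx hf]
    · exact activate_orthogonal_stage hf _ _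
  have hA := hL.closed x hxS hxb
  dsimp only
  rw [hact]
  set new := activate (ω x) (σ x) (L x) with hnew
  unfold potential
  simp only
  set N := (new.map fun c => x + step c.1).toFinset with hN
  have hcard : N.card ≤ 2 :=
    (List.toFinset_card_le _).trans (by rw [List.length_map]; exact activate_length_le _ _ _)
  have h1 : ∑ v ∈ N.filter (fun y => y ∉ boundary R), 3 ^ κ v < 3 ^ κ x := by
    have hb : ∀ v ∈ N.filter (fun y => y ∉ boundary R), 3 ^ κ v * 3 ≤ 3 ^ κ x := by
      intro v hv
      have hv := (Finset.mem_filter.1 hv).1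
      rw [hN, List.mem_toFinset, List.mem_map] at hv
      obtain ⟨c, hc, rfl⟩ := hv
      rw [← pow_succ]
      exact Nat.pow_le_pow_right (by norm_num) (hA c hc).2.2.1
    have hc : (N.filter (fun y => y ∉ boundary R)).card ≤ 2 :=
      (Finset.card_filter_le _ _).trans hcard
    have := Finset.sum_le_card_nsmul _ _ _ hb
    rw [← Finset.sum_mul, smul_eq_mul] at this
    have hpos : 0 < 3 ^ κ x := by positivity
    nlinarith [Nat.mul_le_mul_right (3 ^ κ x) hc]
  have h2 : ∑ v ∈ s.active.erase x, 3 ^ κ v + 3 ^ κ x = ∑ v ∈ s.active, 3 ^ κ v :=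
    Finset.sum_erase_add _ _ hx
  -- New sites that were already active count once in the union, which only lowers the potential.
  have h3 := Finset.sum_union_inter (s₁ := N.filter (fun y => y ∉ boundary R))
    (s₂ := s.active.erase x) (f := fun v => 3 ^ κ v)
  omega

theorem IsLabelling.exists_finish {R : ℕ} {ω : Env} {x₀ : Site} {j : Dir} {S : Site → Prop}
    {L : Site → Instruction} {σ κ : Site → ℕ} (hL : IsLabelling R ω x₀ j S L σ κ) :
    ∃ t, (explore R ω x₀ j t).active = ∅ := by
  by_contra! hn
  have key : ∀ t, potential κ (explore R ω x₀ j t) + t ≤ potential κ (explore R ω x₀ j 0) := by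
    intro t
    induction t with
    | zero => simp
    | succ t ih =>
      have h := hL.potential_update_lt (hL.follows_explore t) (hn t)
      have he : explore R ω x₀ j (t + 1) = update R ω (explore R ω x₀ j t) :=
        Function.iterate_succ_apply' _ _ _
      rw [he]
      omega
  have := key (potential κ (explore R ω x₀ j 0) + 1)
  omega

/-- When the process stops every visited site is deactivated, hence treated unless it lies on the
boundary. From here on the dynamics can be forgotten. -/
theorem IsLabelling.exists_visited {R : ℕ} {ω : Env} {x₀ : Site} {j : Dir} {S : Site → Prop}
    {L : Site → Instruction} {σ κ : Site → ℕ} (hL : IsLabelling R ω x₀ j S L σ κ) :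
    ∃ V : Set Site, x₀ ∈ V ∧ (∀ v ∈ V, S v ∧ (component R ω x₀ j).instr v = L v) ∧
      (∀ e ∈ (component R ω x₀ j).edges, e.1 ∈ V) ∧
      ∀ v ∈ V, v ∉ boundary R → ∀ c ∈ activate (ω v) (σ v) (L v),
        (v, c.1) ∈ (component R ω x₀ j).edges ∧ v + step c.1 ∈ V := by
  have hfin : (component R ω x₀ j).active = ∅ := Nat.sInf_mem hL.exists_finish
  have hf : Follows R ω x₀ S L σ (component R ω x₀ j) := hL.follows_explore _
  refine ⟨(component R ω x₀ j).deactivated, ?_, ?_, ?_, ?_⟩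
  · simpa [hfin] using hf.start
  · intro v hv
    exact hf.label v (Finset.mem_union_right _ hv)
  · intro e he
    simpa [hfin] using hf.source e he
  · intro v hv hb c hc
    simpa [hfin] using hf.treated v hv hb c hc

/-! ### The tree drawn by one exploration -/

/-- The data of the tree drawn by an exploration: it goes in direction `d` up to the coordinate `m`
along `d`, where it turns into the direction `k` and, at the coordinate `n` along `k`, bifurcates
for the second time, its first choice being `k'`. -/
structure TreeData (R : ℕ) (ω : Env) (x₀ : Site) (d k k' : Dir) (m n : ℤ) : Prop where
  orth : Orth d k
  start : coord k x₀ = 0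
  neg_lt : -(R : ℤ) < coord d x₀
  lt : coord d x₀ < R
  le_m : coord d x₀ ≤ m
  m_le : m ≤ R
  one_le : 1 ≤ n
  n_le : n ≤ R
  line : ∀ v, coord k v = 0 → coord d x₀ ≤ coord d v → coord d v < m → CanForward (ω v) d
  first : ∀ v, coord k v = 0 → coord d v = m → v ∉ boundary R →
    ¬ CanForward (ω v) d ∧ bif₁ (ω v) d = k
  stem : ∀ v, coord d v = m → 1 ≤ coord k v → coord k v < n → CanForward (ω v) k
  second : ∀ v, coord d v = m → coord k v = n → v ∉ boundary R →
    ¬ CanForward (ω v) k ∧ bif₁ (ω v) k = k'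
  turn : k' = d ∨ k' = d.rev

/-- The site with given coordinates. -/
def siteAt (d k : Dir) (u w : ℤ) : Site := u • step d + w • step k

theorem Orth.coord_siteAt_left {d k : Dir} (h : Orth d k) (u w : ℤ) :
    coord d (siteAt d k u w) = u := by
  have h1 := coord_step_self d
  have h2 := h.coord_step
  simp only [coord, siteAt, Prod.fst_add, Prod.snd_add, Prod.smul_fst, Prod.smul_snd,
    smul_eq_mul] at h1 h2 ⊢
  linear_combination u * h1 + w * h2

theorem Orth.coord_siteAt_right {d k : Dir} (h : Orth d k) (u w : ℤ) :
    coord k (siteAt d k u w) = w := by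
  have h1 := coord_step_self k
  have h2 := h.symm.coord_step
  simp only [coord, siteAt, Prod.fst_add, Prod.snd_add, Prod.smul_fst, Prod.smul_snd,
    smul_eq_mul] at h1 h2 ⊢
  linear_combination w * h1 + u * h2

theorem Orth.eq_siteAt {d k : Dir} (h : Orth d k) (v : Site) :
    v = siteAt d k (coord d v) (coord k v) :=
  h.coord_ext (h.coord_siteAt_left _ _).symm (h.coord_siteAt_right _ _).symm

theorem exists_first {p : ℤ → Prop} {a b : ℤ} (hab : a ≤ b) (hb : p b) :
    ∃ c, a ≤ c ∧ c ≤ b ∧ p c ∧ ∀ i, a ≤ i → i < c → ¬ p i := by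
  classical
  have hex : ∃ t : ℕ, p (a + t) := ⟨(b - a).toNat, by rwa [show a + ((b - a).toNat : ℤ) = b by omega]⟩
  refine ⟨a + Nat.find hex, by omega, ?_, Nat.find_spec hex, ?_⟩
  · have : Nat.find hex ≤ (b - a).toNat :=
      Nat.find_min' hex (by rwa [show a + ((b - a).toNat : ℤ) = b by omega])
    omega
  · intro i hi hlt hp
    have := Nat.find_min hex (m := (i - a).toNat) (by omega)
    exact this (by rwa [show a + ((i - a).toNat : ℤ) = i by omega])

/-- Take for `m` the first position on the ray that is on the boundary or forbids the forward move,
and for `n` the first such height on the column. If the boundary comes first there is no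
bifurcation, and an arbitrary admissible direction serves as `k` or `k'`. -/
theorem exists_treeData {R : ℕ} (hR : 2 ≤ R) (ω : Env) (x₀ : Site) (d : Dir)
    (h0 : ∀ k, Orth d k → coord k x₀ = 0) (h1 : -1 ≤ coord d x₀) (h2 : coord d x₀ ≤ 1) :
    ∃ k k' m n, TreeData R ω x₀ d k k' m n := by
  obtain ⟨k₀, hk₀⟩ := exists_orth d
  have hbd : ∀ u w : ℤ, -(R : ℤ) ≤ u → u ≤ R → -(R : ℤ) ≤ w → w ≤ R → ∀ k, Orth d k →
      (siteAt d k u w ∈ boundary R ↔ u = R ∨ u = -R ∨ w = R ∨ w = -R) := by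
    intro u w hu hu' hw hw' k hk
    rw [hk.boundary_iff ((hk.inBox_iff R _).2 (by
      rw [hk.coord_siteAt_left, hk.coord_siteAt_right]; omega)),
      hk.coord_siteAt_left, hk.coord_siteAt_right]
  obtain ⟨m, hm1, hm2, hm, hmin⟩ := exists_first
    (p := fun u => siteAt d k₀ u 0 ∈ boundary R ∨ ¬ CanForward (ω (siteAt d k₀ u 0)) d)
    (a := coord d x₀) (b := R) (by omega)
    (Or.inl ((hbd R 0 (by omega) (by omega) (by omega) (by omega) k₀ hk₀).2 (by omega)))
  obtain ⟨k, hk, hkf⟩ : ∃ k, Orth d k ∧ (siteAt d k₀ m 0 ∉ boundary R →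
      ¬ CanForward (ω (siteAt d k₀ m 0)) d ∧ bif₁ (ω (siteAt d k₀ m 0)) d = k) := by
    by_cases hb : siteAt d k₀ m 0 ∈ boundary R
    · exact ⟨k₀, hk₀, fun h => absurd hb h⟩
    · have := hm.resolve_left hb
      exact ⟨_, orth_bif₁ this, fun _ => ⟨this, rfl⟩⟩
  have hline : ∀ v, coord k v = 0 → v = siteAt d k₀ (coord d v) 0 := by
    intro v hv
    have : coord k₀ v = 0 := by
      rcases hk.eq_or_eq_rev hk₀ with rfl | rfl
      · exact hv
      · rw [coord_rev, hv, neg_zero]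
    conv_lhs => rw [hk₀.eq_siteAt v, this]
  obtain ⟨n, hn1, hn2, hn, hnmin⟩ := exists_first
    (p := fun w => siteAt d k m w ∈ boundary R ∨ ¬ CanForward (ω (siteAt d k m w)) k)
    (a := 1) (b := R) (by omega)
    (Or.inl ((hbd m R (by omega) (by omega) (by omega) (by omega) k hk).2 (by omega)))
  obtain ⟨k', hk', hkf'⟩ : ∃ k', (k' = d ∨ k' = d.rev) ∧ (siteAt d k m n ∉ boundary R →
      ¬ CanForward (ω (siteAt d k m n)) k ∧ bif₁ (ω (siteAt d k m n)) k = k') := by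
    by_cases hb : siteAt d k m n ∈ boundary R
    · exact ⟨d, Or.inl rfl, fun h => absurd hb h⟩
    · have := hn.resolve_left hb
      exact ⟨_, hk.symm.eq_or_eq_rev (orth_bif₁ this), fun _ => ⟨this, rfl⟩⟩
  refine ⟨k, k', m, n, hk, h0 k hk, by omega, by omega, hm1, hm2, hn1, hn2, ?_, ?_, ?_, ?_, hk'⟩
  · intro v hv hv1 hv2
    rw [hline v hv]
    exact not_not.1 fun h => hmin _ hv1 hv2 (Or.inr h)
  · intro v hv hvm hb
    rw [hline v hv, hvm] at hb ⊢
    exact hkf hb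
  · intro v hv hv1 hv2
    rw [hk.eq_siteAt v, hv]
    exact not_not.1 fun h => hnmin _ hv1 hv2 (Or.inr h)
  · intro v hv hvn hb
    rw [hk.eq_siteAt v, hv, hvn] at hb ⊢
    exact hkf' hb

/-! ### Regions of the tree and their instructions -/

/-- The sites that an exploration may visit. -/
def treeSites (R : ℕ) (d k : Dir) (u₀ m n : ℤ) (v : Site) : Prop :=
  InBox R v ∧ ((coord k v = 0 ∧ u₀ ≤ coord d v ∧ coord d v ≤ m) ∨
    (coord k v ≤ 0 ∧ m ≤ coord d v) ∨ (1 ≤ coord k v ∧ coord d v = m) ∨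
    (1 ≤ coord k v ∧ n ≤ coord k v))

/-- The instruction of a site of the tree. -/
noncomputable def treeLabel (d k k' : Dir) (m n : ℤ) (v : Site) : Instruction :=
  if coord k v ≤ 0 then
    if coord k v = 0 ∧ coord d v ≤ m then .forward d else .orthogonal d k.rev
  else if coord d v = m ∧ coord k v ≤ n then .forward k
  else if m < coord d v ∨ (coord d v = m ∧ k' ≠ d) then .orthogonal k d else .orthogonal k d.rev

/-- The number of bifurcations before a site of the tree with a forward instruction. -/
def treeStage (k : Dir) (v : Site) : ℕ := if coord k v ≤ 0 then 0 else 1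

/-- A quantity that decreases along the tree. -/
def treeRank (R : ℕ) (d k : Dir) (m : ℤ) (v : Site) : ℕ :=
  (5 * (R : ℤ) + 5 - if coord k v = 0 ∧ coord d v ≤ m then coord d v - m
    else ((coord d v - m).natAbs + (coord k v).natAbs : ℕ)).toNat

section label

variable {d k k' : Dir} {m n : ℤ} {v : Site}

theorem treeLabel_line (h : coord k v = 0) (h' : coord d v ≤ m) :
    treeLabel d k k' m n v = .forward d := by
  rw [treeLabel, if_pos (by omega), if_pos ⟨h, h'⟩]

theorem treeLabel_below (h : coord k v ≤ 0) (h' : ¬ (coord k v = 0 ∧ coord d v ≤ m)) :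
    treeLabel d k k' m n v = .orthogonal d k.rev := by
  rw [treeLabel, if_pos h, if_neg h']

theorem treeLabel_stem (h : 1 ≤ coord k v) (h₁ : coord k v ≤ n) (h₂ : coord d v = m) :
    treeLabel d k k' m n v = .forward k := by
  rw [treeLabel, if_neg (by omega), if_pos ⟨h₂, h₁⟩]

theorem treeLabel_outer (h : 1 ≤ coord k v)
    (h' : m < coord d v ∨ (coord d v = m ∧ n < coord k v ∧ k' ≠ d)) :
    treeLabel d k k' m n v = .orthogonal k d := by
  rw [treeLabel, if_neg (by omega), if_neg (by omega), if_pos]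
  exact h'.imp id fun h => ⟨h.1, h.2.2⟩

theorem treeLabel_inner (h : 1 ≤ coord k v)
    (h' : coord d v < m ∨ (coord d v = m ∧ n < coord k v ∧ k' = d)) :
    treeLabel d k k' m n v = .orthogonal k d.rev := by
  rw [treeLabel, if_neg (by omega), if_neg (by omega), if_neg]
  rintro (h₁ | ⟨h₁, h₂⟩)
  · omega
  · rcases h' with h' | h'
    · omega
    · exact h₂ h'.2.2

end label

theorem coord_add_step_self (k : Dir) (v : Site) : coord k (v + step k) = coord k v + 1 := by
  rw [coord_add, coord_step_self]

theorem coord_add_step_rev (k : Dir) (v : Site) : coord k (v + step k.rev) = coord k v - 1 := by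
  rw [coord_add, coord_step_rev]; rfl

theorem Orth.coord_add_step {d k : Dir} (h : Orth d k) (v : Site) :
    coord d (v + step k) = coord d v := by
  rw [coord_add, h.coord_step, add_zero]

theorem rev_ne (d : Dir) : d.rev ≠ d := by
  revert d; decide

/-- Up to the first turn the rank measures progress along the segment, afterwards the `ℓ¹` distance
from the turning point. In the box this distance is at most `3 * R`, so the constant `5 * R + 5`
prevents truncation by `toNat`. -/
theorem treeRank_lt {R : ℕ} {d k : Dir} {m : ℤ} {v y : Site} (ho : Orth d k) (hy : InBox R y)
    (hm : -(R : ℤ) ≤ m) (hm' : m ≤ R)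
    (h : (coord k v = 0 ∧ coord d v ≤ m ∧
        (¬ (coord k y = 0 ∧ coord d y ≤ m) ∨ coord d v < coord d y)) ∨
      (¬ (coord k v = 0 ∧ coord d v ≤ m) ∧ ¬ (coord k y = 0 ∧ coord d y ≤ m) ∧
        (coord d v - m).natAbs + (coord k v).natAbs <
          (coord d y - m).natAbs + (coord k y).natAbs)) :
    treeRank R d k m y < treeRank R d k m v := by
  have := (ho.inBox_iff R y).1 hy
  unfold treeRank
  split_ifs <;> omega

namespace TreeData

variable {R : ℕ} {ω : Env} {x₀ : Site} {d k k' : Dir} {m n : ℤ}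

theorem activate_line (T : TreeData R ω x₀ d k k' m n) {v : Site} (h : coord k v = 0)
    (h₁ : coord d x₀ ≤ coord d v) (h₂ : coord d v < m) :
    activate (ω v) (treeStage k v) (treeLabel d k k' m n v) = [(d, .forward d)] := by
  rw [treeLabel_line h h₂.le, activate_of_canForward (T.line v h h₁ h₂)]

theorem activate_first (T : TreeData R ω x₀ d k k' m n) {v : Site} (h : coord k v = 0)
    (h₁ : coord d v = m) (hb : v ∉ boundary R) :
    activate (ω v) (treeStage k v) (treeLabel d k k' m n v) =
      [(k, .forward k), (bif₂ (ω v) d, .orthogonal d k.rev)] := by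
  obtain ⟨hf, hk⟩ := T.first v h h₁ hb
  rw [treeLabel_line h h₁.le, treeStage, if_pos h.le, activate_of_even hf rfl, hk]

theorem activate_below {v : Site} (h : coord k v ≤ 0) (h' : ¬ (coord k v = 0 ∧ coord d v ≤ m)) :
    activate (ω v) (treeStage k v) (treeLabel d k k' m n v) =
      [(best (ω v) {d, k.rev}, .orthogonal d k.rev)] := by
  rw [treeLabel_below h h']; rfl

theorem activate_stem (T : TreeData R ω x₀ d k k' m n) {v : Site} (h : coord d v = m)
    (h₁ : 1 ≤ coord k v) (h₂ : coord k v < n) :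
    activate (ω v) (treeStage k v) (treeLabel d k k' m n v) = [(k, .forward k)] := by
  rw [treeLabel_stem h₁ h₂.le h, activate_of_canForward (T.stem v h h₁ h₂)]

theorem activate_second (T : TreeData R ω x₀ d k k' m n) {v : Site} (h : coord d v = m)
    (h₁ : coord k v = n) (hb : v ∉ boundary R) :
    activate (ω v) (treeStage k v) (treeLabel d k k' m n v) =
      [(k', .orthogonal k k'), (bif₂ (ω v) k, .orthogonal k k'.rev)] := by
  obtain ⟨hf, hk⟩ := T.second v h h₁ hb
  have := T.one_le
  rw [treeLabel_stem (by omega) h₁.le h, treeStage, if_neg (by omega),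
    activate_of_odd hf (by norm_num), hk]

theorem activate_outer {v : Site} (h : 1 ≤ coord k v)
    (h' : m < coord d v ∨ (coord d v = m ∧ n < coord k v ∧ k' ≠ d)) :
    activate (ω v) (treeStage k v) (treeLabel d k k' m n v) =
      [(best (ω v) {k, d}, .orthogonal k d)] := by
  rw [treeLabel_outer h h']; rfl

theorem activate_inner {v : Site} (h : 1 ≤ coord k v)
    (h' : coord d v < m ∨ (coord d v = m ∧ n < coord k v ∧ k' = d)) :
    activate (ω v) (treeStage k v) (treeLabel d k k' m n v) =
      [(best (ω v) {k, d.rev}, .orthogonal k d.rev)] := by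
  rw [treeLabel_inner h h']; rfl

theorem bif₂_first (T : TreeData R ω x₀ d k k' m n) {v : Site} (h : coord k v = 0)
    (h₁ : coord d v = m) (hb : v ∉ boundary R) :
    bif₂ (ω v) d = d ∨ bif₂ (ω v) d = k.rev := by
  obtain ⟨hf, hk⟩ := T.first v h h₁ hb
  have := bif₂_eq hf
  rwa [hk] at this

theorem bif₂_second (T : TreeData R ω x₀ d k k' m n) {v : Site} (h : coord d v = m)
    (h₁ : coord k v = n) (hb : v ∉ boundary R) :
    bif₂ (ω v) k = k ∨ bif₂ (ω v) k = k'.rev := by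
  obtain ⟨hf, hk⟩ := T.second v h h₁ hb
  have := bif₂_eq hf
  rwa [hk] at this

-- Each region is sent by its rule into regions labelled by the instruction handed over. The
-- delicate place is the column above the second bifurcation: it is entered only if the second
-- choice continues in direction `k`, so it belongs to the corner opposite to `k'`.
set_option maxHeartbeats 1000000 in
theorem isLabelling (T : TreeData R ω x₀ d k k' m n) :
    IsLabelling R ω x₀ d (treeSites R d k (coord d x₀) m n) (treeLabel d k k' m n)
      (treeStage k) (treeRank R d k m) := by
  have ho := T.orth
  obtain ⟨-, hs, h1, h2, h3, h4, h5, h6, -, -, -, -, hturn⟩ := id T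
  have hbox : InBox R x₀ := (ho.inBox_iff R x₀).2 (by omega)
  refine ⟨⟨hbox, Or.inl ⟨hs, le_rfl, h3⟩⟩, ?_, treeLabel_line hs h3, ?_, ?_⟩
  · rw [ho.boundary_iff hbox]; omega
  · rw [treeStage, if_pos hs.le]
  intro v hv hb c hc
  obtain ⟨hvbox, hreg⟩ := hv
  have hcoord := (ho.inBox_iff R v).1 hvbox
  have hm1 : -(R : ℤ) ≤ m := by omega
  have hm2 : m ≤ R := h4
  have hnb := hb
  rw [ho.boundary_iff hvbox] at hnb
  have hgo : ∀ c : Dir, InBox R (v + step c) := hvbox.add_step hb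
  have ed := coord_add_step_self d v
  have ed' := ho.symm.coord_add_step v
  have ek := ho.coord_add_step v
  have ek' := coord_add_step_self k v
  have erd := coord_add_step_rev d v
  have erd' := ho.symm.rev_right.coord_add_step v
  have erk := ho.rev_right.coord_add_step v
  have erk' := coord_add_step_rev k v
  by_cases hline : coord k v = 0 ∧ coord d v < m
  · rw [T.activate_line hline.1 (by omega) hline.2, List.mem_singleton] at hc
    subst hc
    dsimp only
    refine ⟨⟨hgo _, by omega⟩, treeLabel_line (by omega) (by omega), ?_, fun _ => ?_⟩
    · exact treeRank_lt ho (hgo _) hm1 hm2 (by omega)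
    · rw [treeLabel_line hline.1 hline.2.le, treeStage, treeStage, if_pos (by omega),
        if_pos (by omega), bifCount, if_pos (T.line v hline.1 (by omega) hline.2)]
  by_cases hfirst : coord k v = 0 ∧ coord d v = m
  · rw [T.activate_first hfirst.1 hfirst.2 hb] at hc
    simp only [List.mem_cons, List.not_mem_nil, or_false] at hc
    rcases hc with rfl | rfl <;> dsimp only
    · refine ⟨⟨hgo _, by omega⟩, treeLabel_stem (by omega) (by omega) (by omega), ?_, fun _ => ?_⟩
      · exact treeRank_lt ho (hgo _) hm1 hm2 (by omega)
      · rw [treeLabel_line hfirst.1 hfirst.2.le, treeStage, treeStage, if_neg (by omega),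
          if_pos (by omega), bifCount, if_neg (T.first v hfirst.1 hfirst.2 hb).1]
    · rcases T.bif₂_first hfirst.1 hfirst.2 hb with h | h <;> simp only [h]
      · refine ⟨⟨hgo _, by omega⟩, treeLabel_below (by omega) (by omega), ?_, fun h => h.elim⟩
        exact treeRank_lt ho (hgo _) hm1 hm2 (by omega)
      · refine ⟨⟨hgo _, by omega⟩, treeLabel_below (by omega) (by omega), ?_, fun h => h.elim⟩
        exact treeRank_lt ho (hgo _) hm1 hm2 (by omega)
  by_cases hbelow : coord k v ≤ 0
  · rw [activate_below hbelow (by omega), List.mem_singleton] at hc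
    subst hc
    dsimp only
    rcases best_pair (ω v) d k.rev with h | h <;> simp only [h]
    · refine ⟨⟨hgo _, by omega⟩, treeLabel_below (by omega) (by omega), ?_, fun h => h.elim⟩
      exact treeRank_lt ho (hgo _) hm1 hm2 (by omega)
    · refine ⟨⟨hgo _, by omega⟩, treeLabel_below (by omega) (by omega), ?_, fun h => h.elim⟩
      exact treeRank_lt ho (hgo _) hm1 hm2 (by omega)
  by_cases hstem : coord d v = m ∧ coord k v < n
  · rw [T.activate_stem hstem.1 (by omega) hstem.2, List.mem_singleton] at hc
    subst hc
    dsimp only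
    refine ⟨⟨hgo _, by omega⟩, treeLabel_stem (by omega) (by omega) (by omega), ?_, fun _ => ?_⟩
    · exact treeRank_lt ho (hgo _) hm1 hm2 (by omega)
    · rw [treeLabel_stem (by omega) hstem.2.le hstem.1, treeStage, treeStage, if_neg (by omega),
        if_neg (by omega), bifCount, if_pos (T.stem v hstem.1 (by omega) hstem.2)]
  have hne : d.rev ≠ d := rev_ne d
  by_cases hsecond : coord d v = m ∧ coord k v = n
  · rw [T.activate_second hsecond.1 hsecond.2 hb] at hc
    simp only [List.mem_cons, List.not_mem_nil, or_false] at hc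
    have hbif := T.bif₂_second hsecond.1 hsecond.2 hb
    rcases hc with rfl | rfl <;> dsimp only
    · rcases hturn with rfl | rfl
      · refine ⟨⟨hgo _, by omega⟩, treeLabel_outer (by omega) (by omega), ?_, fun h => h.elim⟩
        exact treeRank_lt ho (hgo _) hm1 hm2 (by omega)
      · refine ⟨⟨hgo _, by omega⟩, treeLabel_inner (by omega) (by omega), ?_, fun h => h.elim⟩
        exact treeRank_lt ho (hgo _) hm1 hm2 (by omega)
    · rcases hturn with rfl | rfl
      · rcases hbif with h | h <;> simp only [h]
        · refine ⟨⟨hgo _, by omega⟩, treeLabel_inner (by omega) (Or.inr ⟨by omega, by omega, rfl⟩),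
            ?_, fun h => h.elim⟩
          exact treeRank_lt ho (hgo _) hm1 hm2 (by omega)
        · refine ⟨⟨hgo _, by omega⟩, treeLabel_inner (by omega) (by omega), ?_, fun h => h.elim⟩
          exact treeRank_lt ho (hgo _) hm1 hm2 (by omega)
      · rw [Fin.rev_rev] at hbif ⊢
        rcases hbif with h | h <;> simp only [h]
        · refine ⟨⟨hgo _, by omega⟩, treeLabel_outer (by omega) (Or.inr ⟨by omega, by omega, hne⟩),
            ?_, fun h => h.elim⟩
          exact treeRank_lt ho (hgo _) hm1 hm2 (by omega)
        · refine ⟨⟨hgo _, by omega⟩, treeLabel_outer (by omega) (by omega), ?_, fun h => h.elim⟩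
          exact treeRank_lt ho (hgo _) hm1 hm2 (by omega)
  by_cases houter : m < coord d v ∨ (coord d v = m ∧ n < coord k v ∧ k' ≠ d)
  · rw [activate_outer (by omega) houter, List.mem_singleton] at hc
    subst hc
    dsimp only
    rcases best_pair (ω v) k d with h | h <;> simp only [h]
    · refine ⟨⟨hgo _, by omega⟩, treeLabel_outer (by omega) ?_, ?_, fun h => h.elim⟩
      · exact houter.imp (by omega) fun h => ⟨by omega, by omega, h.2.2⟩
      · exact treeRank_lt ho (hgo _) hm1 hm2 (by omega)
    · refine ⟨⟨hgo _, by omega⟩, treeLabel_outer (by omega) (by omega), ?_, fun h => h.elim⟩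
      exact treeRank_lt ho (hgo _) hm1 hm2 (by omega)
  have hinner : coord d v < m ∨ (coord d v = m ∧ n < coord k v ∧ k' = d) := by
    by_cases hk : k' = d
    · by_cases hm : coord d v = m
      · exact Or.inr ⟨hm, by omega, hk⟩
      · exact Or.inl (by omega)
    · refine Or.inl ?_
      by_contra hlt
      exact houter (by
        by_cases hm : coord d v = m
        · exact Or.inr ⟨hm, by omega, hk⟩
        · exact Or.inl (by omega))
  rw [activate_inner (by omega) hinner, List.mem_singleton] at hc
  subst hc
  dsimp only
  rcases best_pair (ω v) k d.rev with h | h <;> simp only [h]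
  · refine ⟨⟨hgo _, by omega⟩, treeLabel_inner (by omega) ?_, ?_, fun h => h.elim⟩
    · exact hinner.imp (by omega) fun h => ⟨by omega, by omega, h.2.2⟩
    · exact treeRank_lt ho (hgo _) hm1 hm2 (by omega)
  · refine ⟨⟨hgo _, by omega⟩, treeLabel_inner (by omega) (by omega), ?_, fun h => h.elim⟩
    exact treeRank_lt ho (hgo _) hm1 hm2 (by omega)

end TreeData

/-! ### Flows along paths -/

/-- `f` is the indicator of the edges of a path from `s` to the boundary of the box, all of whose
edges satisfy `P`. -/
structure IsPathFlow (R : ℕ) (s : Site) (P : Site → Dir → Prop) (f : Site → Dir → ℝ) : Prop where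
  zero_or_one : ∀ x c, f x c = 0 ∨ (f x c = 1 ∧ P x c)
  div : ∃ t ∈ boundary R, ∀ x,
    divergence f x = (if x = s then 1 else 0) - (if x = t then 1 else 0)

theorem divergence_add (f g : Site → Dir → ℝ) (x : Site) :
    divergence (fun y c => f y c + g y c) x = divergence f x + divergence g x := by
  simp only [divergence, Finset.sum_add_distrib]; ring

theorem divergence_mul (b : ℝ) (f : Site → Dir → ℝ) (x : Site) :
    divergence (fun y c => b * f y c) x = b * divergence f x := by
  simp only [divergence, ← Finset.mul_sum]; ring

theorem divergence_edge (v : Site) (c : Dir) (x : Site) :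
    divergence (fun y l => if y = v ∧ l = c then 1 else 0) x =
      (if x = v then 1 else 0) - (if x = v + step c then 1 else 0) := by
  have h1 : ∀ l, (x - step l = v ∧ l = c) ↔ (x = v + step c ∧ l = c) := by
    intro l
    constructor
    · rintro ⟨h, rfl⟩; exact ⟨sub_eq_iff_eq_add.1 h, rfl⟩
    · rintro ⟨h, rfl⟩; exact ⟨sub_eq_iff_eq_add.2 h, rfl⟩
  simp only [divergence, h1, ite_and]
  congr 1 <;> split_ifs <;> simp

/-- Edges are followed until the boundary, and the decrease of `κ` forces arrival. The bound on `κ`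
along the support shows that the rest of the path never leaves `v` again, so values stay in `{0,
1}`. -/
theorem exists_pathFlow {R : ℕ} {P : Site → Dir → Prop} {A : Site → Prop} (κ : Site → ℕ)
    (h : ∀ v, A v → v ∉ boundary R → ∃ c, P v c ∧ A (v + step c) ∧ κ (v + step c) < κ v)
    {v : Site} (hv : A v) : ∃ f, IsPathFlow R v P f := by
  suffices H : ∀ N v, κ v ≤ N → A v →
      ∃ f, IsPathFlow R v P f ∧ ∀ x c, f x c ≠ 0 → κ x ≤ κ v by
    obtain ⟨f, hf, -⟩ := H _ v le_rfl hv
    exact ⟨f, hf⟩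
  intro N
  induction N with
  | zero =>
    intro v hN hv
    by_cases hb : v ∈ boundary R
    · exact ⟨fun _ _ => 0, ⟨by simp, v, hb, by simp [divergence]⟩, by simp⟩
    · obtain ⟨c, -, -, hlt⟩ := h v hv hb
      omega
  | succ N ih =>
    intro v hN hv
    by_cases hb : v ∈ boundary R
    · exact ⟨fun _ _ => 0, ⟨by simp, v, hb, by simp [divergence]⟩, by simp⟩
    · obtain ⟨c, hP, hA, hlt⟩ := h v hv hb
      obtain ⟨f, ⟨hf, t, ht, hdiv⟩, hκ⟩ := ih (v + step c) (by omega) hA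
      have hfv : ∀ l, f v l = 0 := fun l => by
        by_contra hne
        have := hκ v l hne
        omega
      refine ⟨fun y l => (if y = v ∧ l = c then 1 else 0) + f y l, ⟨?_, t, ht, ?_⟩, ?_⟩
      · intro x l
        by_cases hx : x = v ∧ l = c
        · obtain ⟨rfl, rfl⟩ := hx
          right
          simp [hfv, hP]
        · simpa [if_neg hx] using hf x l
      · intro x
        rw [divergence_add (fun y l => if y = v ∧ l = c then 1 else 0) f, divergence_edge, hdiv]
        ring
      · intro x l hne
        by_cases hx : x = v
        · rw [hx]
        · have : f x l ≠ 0 := by simpa [hx] using hne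
          have := hκ x l this
          omega

/-- Three paths from `x₀` to the boundary, and the capacities `cap` of their edges: the paths share
an initial segment in direction `d`, the last two then share a segment in direction `k`, and they
end in the corners formed by `d` and `-k`, by `k` and `d`, and by `k` and `-d`. -/
structure Branches (R : ℕ) (β : Dir → ℝ) (α : Sym2 Dir → ℝ) (cap : Site → Dir → ℝ) (x₀ : Site)
    (d k : Dir) (fB fO fI : Site → Dir → ℝ) : Prop where
  orth : Orth d k
  nonneg : ∀ x c, 0 ≤ cap x c
  pathB : IsPathFlow R x₀ (fun x _ => coord d x₀ ≤ coord d x ∧ coord k x ≤ 0) fB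
  pathO : IsPathFlow R x₀ (fun x _ => coord d x₀ ≤ coord d x ∧ 0 ≤ coord k x) fO
  pathI : IsPathFlow R x₀
    (fun x _ => 0 ≤ coord k x ∧ (coord d x₀ ≤ coord d x ∨ 1 ≤ coord k x)) fI
  capacity : ∀ x c, (fB x c = 0 ∧ fO x c = 0 ∧ fI x c = 0) ∨
    (coord d x₀ ≤ coord d x ∧ β d ≤ cap x c) ∨
    (fB x c = 0 ∧ β k ≤ cap x c) ∨
    (fO x c = 0 ∧ fI x c = 0 ∧ α s(d, k.rev) ≤ cap x c) ∨
    (fB x c = 0 ∧ fI x c = 0 ∧ α s(d, k) ≤ cap x c) ∨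
    (fB x c = 0 ∧ fO x c = 0 ∧ α s(d.rev, k) ≤ cap x c)

/-! ### Three paths inside one tree -/

theorem IsPathFlow.mono {R : ℕ} {s : Site} {P P' : Site → Dir → Prop} {f : Site → Dir → ℝ}
    (h : IsPathFlow R s P f) (hP : ∀ x c, P x c → P' x c) : IsPathFlow R s P' f :=
  ⟨fun x c => (h.zero_or_one x c).imp id fun h => ⟨h.1, hP x c h.2⟩, h.div⟩

theorem componentCapacity_eq {β : Dir → ℝ} {α : Sym2 Dir → ℝ} {ω : Env} {C : State} {x : Site}
    {k : Dir} {I : Instruction} (h : (x, k) ∈ C.edges) (hI : C.instr x = I) :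
    componentCapacity β α ω C x k = edgeCapacity β α (ω x) k I := by
  rw [componentCapacity, if_pos h, hI]

theorem edgeCapacity_of_canForward {β : Dir → ℝ} {α : Sym2 Dir → ℝ} {p : Dir → ℝ} {l : Dir}
    (h : CanForward p l) (k : Dir) : edgeCapacity β α p k (.forward l) = β l :=
  if_pos h

theorem edgeCapacity_bif₁ {β : Dir → ℝ} {α : Sym2 Dir → ℝ} {p : Dir → ℝ} {l k : Dir}
    (h : ¬ CanForward p l) (hk : bif₁ p l = k) : edgeCapacity β α p k (.forward l) = β k :=
  (if_neg h).trans (if_pos hk.symm)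

theorem edgeCapacity_bif₂ {β : Dir → ℝ} {α : Sym2 Dir → ℝ} {p : Dir → ℝ} {l k : Dir}
    (h : ¬ CanForward p l) (hk : bif₁ p l = k) :
    edgeCapacity β α p (bif₂ p l) (.forward l) = α s(l, k.rev) := by
  have hne : bif₂ p l ≠ bif₁ p l := by
    rcases bif₂_eq h with e | e <;> rw [e]
    · exact (orth_bif₁ h).1.symm
    · exact rev_ne _
  rw [← hk]
  exact (if_neg h).trans (if_neg hne)

theorem Orth.tags_ne {d k : Dir} (h : Orth d k) : d ≠ k ∧ k.rev ≠ d ∧ k ≠ d.rev ∧ d.rev ≠ d := by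
  revert h; unfold Orth; revert d k; decide

theorem edgeCapacity_treeLabel_nonneg {β : Dir → ℝ} {α : Sym2 Dir → ℝ} {d k k' : Dir}
    (ho : Orth d k) (hα : ∀ i j, Orth i j → 0 ≤ α s(i, j)) (hβ : ∀ i, 0 ≤ β i) (m n : ℤ)
    (p : Dir → ℝ) (v : Site) (c : Dir) :
    0 ≤ edgeCapacity β α p c (treeLabel d k k' m n v) := by
  have hf : ∀ l, 0 ≤ edgeCapacity β α p c (.forward l) := by
    intro l
    simp only [edgeCapacity]
    split_ifs with h
    · exact hβ _
    · exact hβ _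
    · exact hα _ _ (orth_bif₁ h).rev_right
  unfold treeLabel
  split_ifs
  · exact hf _
  · exact hα _ _ ho.rev_right
  · exact hf _
  · exact hα _ _ ho.symm
  · exact hα _ _ ho.symm.rev_right

/-- Each path records, for its edges, the instruction at the head of the edge. This tag tells which
part of the tree the edge belongs to, hence which paths can share it. -/
theorem TreeData.exists_branches {R : ℕ} {ω : Env} {x₀ : Site} {d k k' : Dir} {m n : ℤ}
    (T : TreeData R ω x₀ d k k' m n) {β : Dir → ℝ} {α : Sym2 Dir → ℝ}
    (hα₀ : ∀ i j, Orth i j → 0 ≤ α s(i, j)) (hα : ∀ i j, Orth i j → α s(i, j) ≤ β i) :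
    ∃ fB fO fI, Branches R β α (componentCapacity β α ω (component R ω x₀ d)) x₀ d k fB fO fI := by
  have hlab := T.isLabelling
  obtain ⟨V, hx₀, hV, hsource, hclosed⟩ := hlab.exists_visited
  have hrank : ∀ v, v ∈ V → v ∉ boundary R →
      ∀ c ∈ activate (ω v) (treeStage k v) (treeLabel d k k' m n v),
        v + step c.1 ∈ V ∧ treeLabel d k k' m n (v + step c.1) = c.2 ∧
        treeRank R d k m (v + step c.1) < treeRank R d k m v ∧
        componentCapacity β α ω (component R ω x₀ d) v c.1 =
          edgeCapacity β α (ω v) c.1 (treeLabel d k k' m n v) := by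
    intro v hv hb c hc
    have h1 := hlab.closed v (hV v hv).1 hb c hc
    have h2 := hclosed v hv hb c hc
    exact ⟨h2.2, h1.2.1, h1.2.2.1, componentCapacity_eq h2.1 (hV v hv).2⟩
  clear hclosed
  have ho := T.orth
  have hnonneg : ∀ x c, 0 ≤ componentCapacity β α ω (component R ω x₀ d) x c := by
    intro x c
    by_cases hc : (x, c) ∈ (component R ω x₀ d).edges
    · rw [componentCapacity_eq hc (hV x (hsource _ hc)).2]
      refine edgeCapacity_treeLabel_nonneg ho hα₀ (fun i => ?_) _ _ _ _ _
      obtain ⟨l, hl⟩ := exists_orth i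
      exact (hα₀ i l hl).trans (hα i l hl)
    · rw [componentCapacity, if_neg hc]
  obtain ⟨-, hs, -, -, h3, -, h5, -, -, -, -, -, hturn⟩ := id T
  have hne := rev_ne d
  set cap := componentCapacity β α ω (component R ω x₀ d)
  obtain ⟨fB, hB⟩ := exists_pathFlow (R := R) (v := x₀) (treeRank R d k m)
    (A := fun v => v ∈ V ∧ coord d x₀ ≤ coord d v ∧ coord k v ≤ 0)
    (P := fun v c => (coord d x₀ ≤ coord d v ∧ coord k v ≤ 0) ∧
      ((treeLabel d k k' m n (v + step c) = .forward d ∧ β d ≤ cap v c) ∨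
        (treeLabel d k k' m n (v + step c) = .orthogonal d k.rev ∧ α s(d, k.rev) ≤ cap v c)))
    (by
      rintro v ⟨hv, hu, hw⟩ hb
      have hreg := (hV v hv).1.2
      have hr := hrank v hv hb
      by_cases hline : coord k v = 0 ∧ coord d v < m
      · rw [T.activate_line hline.1 hu hline.2] at hr
        obtain ⟨h1, h2, h3, h4⟩ := hr _ (List.mem_singleton_self _)
        rw [treeLabel_line hline.1 hline.2.le,
          edgeCapacity_of_canForward (T.line v hline.1 hu hline.2)] at h4
        refine ⟨d, ⟨⟨hu, hw⟩, Or.inl ⟨h2, h4.ge⟩⟩, ⟨h1, ?_, ?_⟩, h3⟩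
        · rw [coord_add_step_self]; omega
        · rw [ho.symm.coord_add_step]; omega
      by_cases hfirst : coord k v = 0 ∧ coord d v = m
      · rw [T.activate_first hfirst.1 hfirst.2 hb] at hr
        obtain ⟨h1, h2, h3, h4⟩ := hr _ (List.mem_cons_of_mem _ (List.mem_singleton_self _))
        obtain ⟨hf, hk⟩ := T.first v hfirst.1 hfirst.2 hb
        rw [treeLabel_line hfirst.1 hfirst.2.le, edgeCapacity_bif₂ hf hk] at h4
        refine ⟨_, ⟨⟨hu, hw⟩, Or.inr ⟨h2, h4.ge⟩⟩, ⟨h1, ?_, ?_⟩, h3⟩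
        · rcases T.bif₂_first hfirst.1 hfirst.2 hb with h | h <;> dsimp only <;> rw [h]
          · rw [coord_add_step_self]; omega
          · rw [ho.rev_right.coord_add_step]; omega
        · rcases T.bif₂_first hfirst.1 hfirst.2 hb with h | h <;> dsimp only <;> rw [h]
          · rw [ho.symm.coord_add_step]; omega
          · rw [coord_add_step_rev]; omega
      · rw [activate_below hw (by omega)] at hr
        obtain ⟨h1, h2, h3, h4⟩ := hr _ (List.mem_singleton_self _)
        rw [treeLabel_below hw (by omega)] at h4
        refine ⟨_, ⟨⟨hu, hw⟩, Or.inr ⟨h2, h4.ge⟩⟩, ⟨h1, ?_, ?_⟩, h3⟩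
        · rcases best_pair (ω v) d k.rev with h | h <;> dsimp only <;> rw [h]
          · rw [coord_add_step_self]; omega
          · rw [ho.rev_right.coord_add_step]; omega
        · rcases best_pair (ω v) d k.rev with h | h <;> dsimp only <;> rw [h]
          · rw [ho.symm.coord_add_step]; omega
          · rw [coord_add_step_rev]; omega)
    ⟨hx₀, le_rfl, hs.le⟩
  obtain ⟨fO, hO⟩ := exists_pathFlow (R := R) (v := x₀) (treeRank R d k m)
    (A := fun v => v ∈ V ∧ coord d x₀ ≤ coord d v ∧ ((coord k v = 0 ∧ coord d v ≤ m) ∨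
      (1 ≤ coord k v ∧ coord k v ≤ n ∧ coord d v = m) ∨
      (n ≤ coord k v ∧ (m < coord d v ∨ (coord d v = m ∧ n < coord k v ∧ k' ≠ d)))))
    (P := fun v c => (coord d x₀ ≤ coord d v ∧ 0 ≤ coord k v) ∧
      ((treeLabel d k k' m n (v + step c) = .forward d ∧ β d ≤ cap v c) ∨
        (treeLabel d k k' m n (v + step c) = .forward k ∧ β k ≤ cap v c) ∨
        (treeLabel d k k' m n (v + step c) = .orthogonal k d ∧ α s(d, k) ≤ cap v c)))
    (by
      rintro v ⟨hv, hu, hw⟩ hb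
      have hr := hrank v hv hb
      by_cases hline : coord k v = 0 ∧ coord d v < m
      · rw [T.activate_line hline.1 hu hline.2] at hr
        obtain ⟨h1, h2, h3, h4⟩ := hr _ (List.mem_singleton_self _)
        rw [treeLabel_line hline.1 hline.2.le,
          edgeCapacity_of_canForward (T.line v hline.1 hu hline.2)] at h4
        refine ⟨d, ⟨⟨hu, by omega⟩, Or.inl ⟨h2, h4.ge⟩⟩, ⟨h1, ?_⟩, h3⟩
        rw [coord_add_step_self, ho.symm.coord_add_step]; omega
      by_cases hfirst : coord k v = 0 ∧ coord d v = m
      · rw [T.activate_first hfirst.1 hfirst.2 hb] at hr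
        obtain ⟨h1, h2, h3, h4⟩ := hr _ List.mem_cons_self
        obtain ⟨hf, hk⟩ := T.first v hfirst.1 hfirst.2 hb
        rw [treeLabel_line hfirst.1 hfirst.2.le, edgeCapacity_bif₁ hf hk] at h4
        refine ⟨k, ⟨⟨hu, by omega⟩, Or.inr (Or.inl ⟨h2, h4.ge⟩)⟩, ⟨h1, ?_⟩, h3⟩
        rw [ho.coord_add_step, coord_add_step_self]; omega
      by_cases hstem : coord d v = m ∧ coord k v < n
      · rw [T.activate_stem hstem.1 (by omega) hstem.2] at hr
        obtain ⟨h1, h2, h3, h4⟩ := hr _ (List.mem_singleton_self _)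
        rw [treeLabel_stem (by omega) hstem.2.le hstem.1,
          edgeCapacity_of_canForward (T.stem v hstem.1 (by omega) hstem.2)] at h4
        refine ⟨k, ⟨⟨hu, by omega⟩, Or.inr (Or.inl ⟨h2, h4.ge⟩)⟩, ⟨h1, ?_⟩, h3⟩
        rw [ho.coord_add_step, coord_add_step_self]; omega
      by_cases hsecond : coord d v = m ∧ coord k v = n
      · rw [T.activate_second hsecond.1 hsecond.2 hb] at hr
        obtain ⟨hf, hk⟩ := T.second v hsecond.1 hsecond.2 hb
        rw [treeLabel_stem (by omega) hsecond.2.le hsecond.1] at hr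
        -- Towards `d` the path takes the first choice if it is `d`, whose capacity `β d` dominates
        -- `α s(d, k)`, and otherwise the second choice, whose capacity is exactly this `α`. The
        -- third path is treated alike with `-d`.
        by_cases hk' : k' = d
        · obtain ⟨h1, h2, h3, h4⟩ := hr _ List.mem_cons_self
          rw [edgeCapacity_bif₁ hf hk] at h4
          dsimp only at h1 h2 h3 h4
          rw [hk'] at h1 h2 h3 h4
          refine ⟨d, ⟨⟨hu, by omega⟩, Or.inr (Or.inr ⟨by rw [hk']; exact h2, ?_⟩)⟩,
            ⟨h1, ?_⟩, h3⟩
          · rw [h4]; exact hα d k ho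
          · rw [ho.symm.coord_add_step, coord_add_step_self]; omega
        · have hk'' := hturn.resolve_left hk'
          obtain ⟨h1, h2, h3, h4⟩ := hr _ (List.mem_cons_of_mem _ (List.mem_singleton_self _))
          have hbif := T.bif₂_second hsecond.1 hsecond.2 hb
          have hrr : k'.rev = d := by rw [hk'', Fin.rev_rev]
          rw [edgeCapacity_bif₂ hf hk] at h4
          rw [hrr] at h2 h4 hbif
          refine ⟨_, ⟨⟨hu, by omega⟩, Or.inr (Or.inr ⟨h2, ?_⟩)⟩, ⟨h1, ?_⟩, h3⟩
          · rw [h4, Sym2.eq_swap]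
          · dsimp only
            rcases hbif with h | h <;> rw [h]
            · rw [ho.coord_add_step, coord_add_step_self]
              exact ⟨hu, Or.inr (Or.inr ⟨by omega, Or.inr ⟨by omega, by omega, hk'⟩⟩)⟩
            · rw [ho.symm.coord_add_step, coord_add_step_self]; omega
      have hreg : n ≤ coord k v ∧
          (m < coord d v ∨ (coord d v = m ∧ n < coord k v ∧ k' ≠ d)) := by
        rcases hw with hw | hw | hw
        · omega
        · omega
        · exact hw
      rw [activate_outer (by omega) hreg.2] at hr
      obtain ⟨h1, h2, h3, h4⟩ := hr _ (List.mem_singleton_self _)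
      rw [treeLabel_outer (by omega) hreg.2] at h4
      refine ⟨_, ⟨⟨hu, by omega⟩, Or.inr (Or.inr ⟨h2, ?_⟩)⟩, ⟨h1, ?_⟩, h3⟩
      · rw [h4, Sym2.eq_swap]; rfl
      · dsimp only
        rcases best_pair (ω v) k d with h | h <;> rw [h]
        · rw [ho.coord_add_step, coord_add_step_self]
          exact ⟨hu, Or.inr (Or.inr ⟨by omega,
            hreg.2.imp id fun h => ⟨h.1, by omega, h.2.2⟩⟩)⟩
        · rw [ho.symm.coord_add_step, coord_add_step_self]; omega)
    ⟨hx₀, le_rfl, Or.inl ⟨hs, h3⟩⟩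
  obtain ⟨fI, hI⟩ := exists_pathFlow (R := R) (v := x₀) (treeRank R d k m)
    (A := fun v => v ∈ V ∧ ((coord d x₀ ≤ coord d v ∧ coord k v = 0 ∧ coord d v ≤ m) ∨
      (1 ≤ coord k v ∧ coord k v ≤ n ∧ coord d v = m) ∨
      (n ≤ coord k v ∧ (coord d v < m ∨ (coord d v = m ∧ n < coord k v ∧ k' = d)))))
    (P := fun v c => (0 ≤ coord k v ∧ (coord d x₀ ≤ coord d v ∨ 1 ≤ coord k v)) ∧
      ((treeLabel d k k' m n (v + step c) = .forward d ∧
          coord d x₀ ≤ coord d v ∧ β d ≤ cap v c) ∨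
        (treeLabel d k k' m n (v + step c) = .forward k ∧ β k ≤ cap v c) ∨
        (treeLabel d k k' m n (v + step c) = .orthogonal k d.rev ∧ α s(d.rev, k) ≤ cap v c)))
    (by
      rintro v ⟨hv, hw⟩ hb
      have hr := hrank v hv hb
      by_cases hline : coord k v = 0 ∧ coord d v < m
      · have hu : coord d x₀ ≤ coord d v := by omega
        rw [T.activate_line hline.1 hu hline.2] at hr
        obtain ⟨h1, h2, h3, h4⟩ := hr _ (List.mem_singleton_self _)
        rw [treeLabel_line hline.1 hline.2.le,
          edgeCapacity_of_canForward (T.line v hline.1 hu hline.2)] at h4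
        refine ⟨d, ⟨by omega, Or.inl ⟨h2, hu, h4.ge⟩⟩, ⟨h1, ?_⟩, h3⟩
        rw [coord_add_step_self, ho.symm.coord_add_step]; omega
      by_cases hfirst : coord k v = 0 ∧ coord d v = m
      · rw [T.activate_first hfirst.1 hfirst.2 hb] at hr
        obtain ⟨h1, h2, h3, h4⟩ := hr _ List.mem_cons_self
        obtain ⟨hf, hk⟩ := T.first v hfirst.1 hfirst.2 hb
        rw [treeLabel_line hfirst.1 hfirst.2.le, edgeCapacity_bif₁ hf hk] at h4
        refine ⟨k, ⟨by omega, Or.inr (Or.inl ⟨h2, h4.ge⟩)⟩, ⟨h1, ?_⟩, h3⟩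
        rw [ho.coord_add_step, coord_add_step_self]; omega
      by_cases hstem : coord d v = m ∧ coord k v < n
      · rw [T.activate_stem hstem.1 (by omega) hstem.2] at hr
        obtain ⟨h1, h2, h3, h4⟩ := hr _ (List.mem_singleton_self _)
        rw [treeLabel_stem (by omega) hstem.2.le hstem.1,
          edgeCapacity_of_canForward (T.stem v hstem.1 (by omega) hstem.2)] at h4
        refine ⟨k, ⟨by omega, Or.inr (Or.inl ⟨h2, h4.ge⟩)⟩, ⟨h1, ?_⟩, h3⟩
        rw [ho.coord_add_step, coord_add_step_self]; omega
      by_cases hsecond : coord d v = m ∧ coord k v = n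
      · rw [T.activate_second hsecond.1 hsecond.2 hb] at hr
        obtain ⟨hf, hk⟩ := T.second v hsecond.1 hsecond.2 hb
        rw [treeLabel_stem (by omega) hsecond.2.le hsecond.1] at hr
        by_cases hk' : k' = d
        · obtain ⟨h1, h2, h3, h4⟩ := hr _ (List.mem_cons_of_mem _ (List.mem_singleton_self _))
          have hbif := T.bif₂_second hsecond.1 hsecond.2 hb
          rw [edgeCapacity_bif₂ hf hk] at h4
          have hrr : k'.rev = d.rev := by rw [hk']
          rw [hrr] at h2 h4 hbif
          refine ⟨_, ⟨by omega, Or.inr (Or.inr ⟨h2, ?_⟩)⟩, ⟨h1, ?_⟩, h3⟩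
          · rw [h4, Sym2.eq_swap]
          · dsimp only
            rcases hbif with h | h <;> rw [h]
            · rw [ho.coord_add_step, coord_add_step_self]
              exact Or.inr (Or.inr ⟨by omega, Or.inr ⟨by omega, by omega, hk'⟩⟩)
            · rw [ho.symm.rev_right.coord_add_step, coord_add_step_rev]; omega
        · have hk'' := hturn.resolve_left hk'
          obtain ⟨h1, h2, h3, h4⟩ := hr _ List.mem_cons_self
          rw [edgeCapacity_bif₁ hf hk] at h4
          dsimp only at h1 h2 h3 h4
          have h2' : treeLabel d k k' m n (v + step d.rev) = .orthogonal k d.rev := by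
            rw [← hk'']; exact h2
          rw [hk''] at h1 h3 h4
          refine ⟨d.rev, ⟨by omega, Or.inr (Or.inr ⟨h2', ?_⟩)⟩, ⟨h1, ?_⟩, h3⟩
          · rw [h4]; exact hα d.rev k ho.rev_left
          · rw [ho.symm.rev_right.coord_add_step, coord_add_step_rev]; omega
      have hreg : n ≤ coord k v ∧
          (coord d v < m ∨ (coord d v = m ∧ n < coord k v ∧ k' = d)) := by
        rcases hw with hw | hw | hw
        · omega
        · omega
        · exact hw
      rw [activate_inner (by omega) hreg.2] at hr
      obtain ⟨h1, h2, h3, h4⟩ := hr _ (List.mem_singleton_self _)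
      rw [treeLabel_inner (by omega) hreg.2] at h4
      refine ⟨_, ⟨by omega, Or.inr (Or.inr ⟨h2, ?_⟩)⟩, ⟨h1, ?_⟩, h3⟩
      · rw [h4, Sym2.eq_swap]; rfl
      · dsimp only
        rcases best_pair (ω v) k d.rev with h | h <;> rw [h]
        · rw [ho.coord_add_step, coord_add_step_self]
          exact Or.inr (Or.inr ⟨by omega, hreg.2.imp id fun h => ⟨h.1, by omega, h.2.2⟩⟩)
        · rw [ho.symm.rev_right.coord_add_step, coord_add_step_rev]; omega)
    ⟨hx₀, Or.inl ⟨le_rfl, hs, h3⟩⟩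
  refine ⟨fB, fO, fI, ho, hnonneg, hB.mono fun x c h => h.1, hO.mono fun x c h => h.1,
    hI.mono fun x c h => h.1, fun x c => ?_⟩
  -- Different corners have different tags, so an edge with a corner tag carries only one path.
  obtain ⟨t1, t2, t3, t4⟩ := ho.tags_ne
  rcases hB.zero_or_one x c with zB | ⟨-, rB, hB | hB⟩
  · rcases hO.zero_or_one x c with zO | ⟨-, rO, hO | hO | hO⟩
    · rcases hI.zero_or_one x c with zI | ⟨-, rI, hI | hI | hI⟩
      · exact Or.inl ⟨zB, zO, zI⟩
      · exact Or.inr (Or.inl hI.2)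
      · exact Or.inr (Or.inr (Or.inl ⟨zB, hI.2⟩))
      · exact Or.inr (Or.inr (Or.inr (Or.inr (Or.inr ⟨zB, zO, hI.2⟩))))
    · exact Or.inr (Or.inl ⟨rO.1, hO.2⟩)
    · exact Or.inr (Or.inr (Or.inl ⟨zB, hO.2⟩))
    · refine Or.inr (Or.inr (Or.inr (Or.inr (Or.inl ⟨zB, ?_, hO.2⟩))))
      refine (hI.zero_or_one x c).resolve_right ?_
      rintro ⟨-, -, ⟨h, -⟩ | ⟨h, -⟩ | ⟨h, -⟩⟩ <;> rw [hO.1] at h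
      · exact Instruction.noConfusion h
      · exact Instruction.noConfusion h
      · injection h with h₁ h₂
        exact t4 h₂.symm
  · exact Or.inr (Or.inl ⟨rB.1, hB.2⟩)
  · refine Or.inr (Or.inr (Or.inr (Or.inl ⟨?_, ?_, hB.2⟩)))
    · refine (hO.zero_or_one x c).resolve_right ?_
      rintro ⟨-, -, ⟨h, -⟩ | ⟨h, -⟩ | ⟨h, -⟩⟩ <;> rw [hB.1] at h
      · exact Instruction.noConfusion h
      · exact Instruction.noConfusion h
      · injection h with h₁ h₂
        exact t1 h₁
    · refine (hI.zero_or_one x c).resolve_right ?_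
      rintro ⟨-, -, ⟨h, -⟩ | ⟨h, -⟩ | ⟨h, -⟩⟩ <;> rw [hB.1] at h
      · exact Instruction.noConfusion h
      · exact Instruction.noConfusion h
      · injection h with h₁ h₂
        exact t1 h₁

/-! ### Combining the paths of the two explorations -/

theorem IsFlow.add {A Z : Set Site} {f g : Site → Dir → ℝ} (hf : IsFlow f A Z) (hg : IsFlow g A Z) :
    IsFlow (fun x c => f x c + g x c) A Z where
  nonneg x c := add_nonneg (hf.nonneg x c) (hg.nonneg x c)
  div_eq_zero x hx := by rw [divergence_add, hf.div_eq_zero x hx, hg.div_eq_zero x hx, add_zero]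
  div_source x hx := by
    rw [divergence_add]; exact add_nonneg (hf.div_source x hx) (hg.div_source x hx)
  div_sink x hx := by
    rw [divergence_add]; exact add_nonpos (hf.div_sink x hx) (hg.div_sink x hx)

theorem IsFlow.mul {A Z : Set Site} {f : Site → Dir → ℝ} (hf : IsFlow f A Z) {b : ℝ} (hb : 0 ≤ b) :
    IsFlow (fun x c => b * f x c) A Z where
  nonneg x c := mul_nonneg hb (hf.nonneg x c)
  div_eq_zero x hx := by rw [divergence_mul, hf.div_eq_zero x hx, mul_zero]
  div_source x hx := by rw [divergence_mul]; exact mul_nonneg hb (hf.div_source x hx)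
  div_sink x hx := by
    rw [divergence_mul]; exact mul_nonpos_of_nonneg_of_nonpos hb (hf.div_sink x hx)

theorem strength_add (f g : Site → Dir → ℝ) (A : Finset Site) :
    strength (fun x c => f x c + g x c) A = strength f A + strength g A := by
  simp only [strength, divergence_add, Finset.sum_add_distrib]

theorem strength_mul (b : ℝ) (f : Site → Dir → ℝ) (A : Finset Site) :
    strength (fun x c => b * f x c) A = b * strength f A := by
  simp only [strength, divergence_mul, Finset.mul_sum]

theorem IsPathFlow.isFlow {R : ℕ} {s : Site} {P : Site → Dir → Prop} {f : Site → Dir → ℝ}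
    (hf : IsPathFlow R s P f) {A : Finset Site} (hs : s ∈ A) (hA : ∀ x ∈ A, x ∉ boundary R) :
    IsFlow f A (boundary R) ∧ strength f A = 1 := by
  obtain ⟨t, ht, hdiv⟩ := hf.div
  have htA : ∀ x ∈ A, x ≠ t := fun x hx h => hA x hx (h ▸ ht)
  refine ⟨⟨fun x c => ?_, fun x hx => ?_, fun x hx => ?_, fun x hx => ?_⟩, ?_⟩
  · rcases hf.zero_or_one x c with h | h
    · exact h.ge
    · rw [h.1]; exact zero_le_one
  · have h1 : x ≠ s := fun h => hx (Or.inl (h ▸ hs))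
    have h2 : x ≠ t := fun h => hx (Or.inr (h ▸ ht))
    rw [hdiv, if_neg h1, if_neg h2, sub_zero]
  · rw [hdiv, if_neg (htA x hx), sub_zero]
    split_ifs <;> norm_num
  · have h1 : x ≠ s := fun h => hA s hs (h ▸ hx)
    rw [hdiv, if_neg h1]
    split_ifs <;> norm_num
  · simp only [strength, hdiv, Finset.sum_sub_distrib]
    rw [Finset.sum_ite_eq' A s, if_pos hs, Finset.sum_eq_zero fun x hx => if_neg (htA x hx),
      sub_zero]

theorem IsPathFlow.eq_zero {R : ℕ} {s : Site} {P : Site → Dir → Prop} {f : Site → Dir → ℝ}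
    (hf : IsPathFlow R s P f) {x : Site} {c : Dir} (h : ¬ P x c) : f x c = 0 :=
  (hf.zero_or_one x c).resolve_right fun h' => h h'.2

theorem IsPathFlow.mul_le {R : ℕ} {s : Site} {P : Site → Dir → Prop} {f : Site → Dir → ℝ}
    (hf : IsPathFlow R s P f) {b : ℝ} (hb : 0 ≤ b) (x : Site) (c : Dir) : b * f x c ≤ b := by
  rcases hf.zero_or_one x c with h | ⟨h, -⟩ <;> rw [h] <;> simp [hb]

/-- Each alternative in `capacity` limits the paths that can use the edge, and one hypothesis bounds
their total weight. -/
theorem Branches.le_capacity {R : ℕ} {β : Dir → ℝ} {α : Sym2 Dir → ℝ} {cap : Site → Dir → ℝ}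
    {x₀ : Site} {d k : Dir} {fB fO fI : Site → Dir → ℝ}
    (H : Branches R β α cap x₀ d k fB fO fI) {b o i : ℝ} (hb : 0 ≤ b) (ho : 0 ≤ o) (hi : 0 ≤ i)
    (hb' : b ≤ α s(d, k.rev)) (ho' : o ≤ α s(d, k)) (hi' : i ≤ α s(d.rev, k)) (hoi : o + i ≤ β k)
    (hboi : b + o + i ≤ β d) (x : Site) (c : Dir) :
    b * fB x c + o * fO x c + i * fI x c ≤ cap x c := by
  have h0 := H.nonneg x c
  have h1 := H.pathB.mul_le hb x c
  have h2 := H.pathO.mul_le ho x c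
  have h3 := H.pathI.mul_le hi x c
  rcases H.capacity x c with h | h | h | h | h | h
  · rw [h.1, h.2.1, h.2.2]; linarith
  · linarith
  · rw [h.1]; linarith
  · rw [h.1, h.2.1]; linarith
  · rw [h.1, h.2.1]; linarith
  · rw [h.1, h.2.1]; linarith

/-- Two paths from `x₀` to the boundary that separate after an initial segment in direction `d`,
one on each side of the axis of direction `d`. -/
structure Sides (R : ℕ) (β : Dir → ℝ) (α : Sym2 Dir → ℝ) (cap : Site → Dir → ℝ) (x₀ : Site)
    (d k : Dir) (g g' : Site → Dir → ℝ) : Prop where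
  left : IsPathFlow R x₀ (fun x _ => coord d x₀ ≤ coord d x ∧ 0 ≤ coord k x) g
  right : IsPathFlow R x₀ (fun x _ => coord d x₀ ≤ coord d x ∧ coord k x ≤ 0) g'
  le_capacity : ∀ s s' : ℝ, 0 ≤ s → 0 ≤ s' → s ≤ α s(d, k) → s' ≤ α s(d, k.rev) → s + s' ≤ β d →
    ∀ x c, s * g x c + s' * g' x c ≤ cap x c

/-- Giving the third path weight `0` removes the stem constraint, since `α s(d, k) ≤ β k`. The
result is symmetric under `k ↦ -k`, so the sides can be named after the stem of the other tree. -/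
theorem Branches.exists_sides {R : ℕ} {β : Dir → ℝ} {α : Sym2 Dir → ℝ} {cap : Site → Dir → ℝ}
    {x₀ : Site} {d k : Dir} {fB fO fI : Site → Dir → ℝ}
    (H : Branches R β α cap x₀ d k fB fO fI) (hα₀ : ∀ i j, Orth i j → 0 ≤ α s(i, j))
    (hα : ∀ i j, Orth i j → α s(i, j) ≤ β i) {l : Dir} (hl : Orth d l) :
    ∃ g g', Sides R β α cap x₀ d l g g' := by
  have key : ∀ s s' : ℝ, 0 ≤ s → 0 ≤ s' → s ≤ α s(d, k) → s' ≤ α s(d, k.rev) → s + s' ≤ β d →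
      ∀ x c, s * fO x c + s' * fB x c ≤ cap x c := by
    intro s s' h1 h2 h3 h4 h5 x c
    have h6 := hα k d H.orth.symm
    rw [Sym2.eq_swap] at h6
    have := H.le_capacity h2 h1 le_rfl h4 h3 (hα₀ _ _ H.orth.rev_left) (by linarith)
      (by linarith) x c
    linarith
  rcases H.orth.eq_or_eq_rev hl with rfl | rfl
  · exact ⟨fO, fB, H.pathO, H.pathB, key⟩
  · refine ⟨fB, fO, H.pathB.mono ?_, H.pathO.mono ?_, ?_⟩
    · intro x _ h
      rw [coord_rev]; omega
    · intro x _ h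
      rw [coord_rev]; omega
    · intro s s' h1 h2 h3 h4 h5 x c
      rw [Fin.rev_rev] at h4
      have := key s' s h2 h1 h4 h3 (by linarith) x c
      linarith

/-- Here `p, q, p', q'` are the corners `{d, k}`, `{d, -k}`, `{-d, k}`, `{-d, -k}`, and `u, u', w`
are the `β` of `d, -d, k`. The bound `i + s ≤ p'` is the shared corner. If `h` failed, the total
could not exceed `u + p' + q'`, which the three bounds on `c` do not control. -/
theorem exists_weights {c p q p' q' u u' w : ℝ} (hp : 0 ≤ p) (hq : 0 ≤ q)
    (hq' : 0 ≤ q') (hp'₀ : 0 ≤ p') (hqu : q ≤ u) (hqu' : q' ≤ u') (hpw : p ≤ w)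
    (h : p + q ≤ u ∨ u' ≤ p' + q') (h₁ : c ≤ u + u') (h₂ : c ≤ q + u' + w)
    (h₃ : c ≤ p + q + p' + q') :
    ∃ b o i s s' : ℝ, 0 ≤ b ∧ 0 ≤ o ∧ 0 ≤ i ∧ 0 ≤ s ∧ 0 ≤ s' ∧ b ≤ q ∧ o ≤ p ∧ i + s ≤ p' ∧
      s' ≤ q' ∧ o + i ≤ w ∧ b + o + i ≤ u ∧ s + s' ≤ u' ∧ c ≤ b + o + i + s + s' := by
  rcases le_total u' (p' + q') with h' | h'
  · rcases le_total u (p + q) with hu | hu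
    · exact ⟨q, u - q, 0, u' - q', q', hq, by linarith, le_rfl, by linarith, hq', le_rfl,
        by linarith, by linarith, le_rfl, by linarith, by linarith, by linarith, by linarith⟩
    -- The third path gets what the stem, the segment and the shared corner leave over. According to
    -- which term is smallest, the total equals the right side of `h₂`, `h₁` or `h₃`.
    · have m1 := min_le_left (w - p) (min (u - q - p) (p' - (u' - q')))
      have m2 := (min_le_right (w - p) (min (u - q - p) (p' - (u' - q')))).trans (min_le_left _ _)
      have m3 := (min_le_right (w - p) (min (u - q - p) (p' - (u' - q')))).trans (min_le_right _ _)
      refine ⟨q, p, min (w - p) (min (u - q - p) (p' - (u' - q'))), u' - q', q', hq, hp,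
        le_min (by linarith) (le_min (by linarith) (by linarith)), by linarith, hq', le_rfl, le_rfl,
        by linarith, le_rfl, by linarith, by linarith, by linarith, ?_⟩
      have : c - q - p - u' ≤ min (w - p) (min (u - q - p) (p' - (u' - q'))) :=
        le_min (by linarith) (le_min (by linarith) (by linarith))
      linarith
  · have hu : p + q ≤ u ∨ u' = p' + q' := h.imp id fun h => le_antisymm h h'
    rcases le_total (p + q) u with hu | hu
    · exact ⟨q, p, 0, p', q', hq, hp, le_rfl, hp'₀, hq', le_rfl, le_rfl, by linarith, le_rfl,
        by linarith, by linarith, by linarith, by linarith⟩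
    · refine ⟨q, u - q, 0, p', q', hq, by linarith, le_rfl, hp'₀, hq', le_rfl, by linarith,
        by linarith, le_rfl, by linarith, by linarith, by linarith, ?_⟩
      rcases h with h | h <;> linarith

/-- The line through `x₀` orthogonal to `d` separates the trees' paths except for `fI`. Behind it
`fI` stays at height at least `1` along `k`, where it can only meet `g`; there `cap` alone is at
least `α s(-d, k)`, which bounds the sum of both weights. -/
theorem Branches.exists_flow {R : ℕ} {β : Dir → ℝ} {α : Sym2 Dir → ℝ} {cap cap' : Site → Dir → ℝ}
    {x₀ y₀ : Site} {d k : Dir} {fB fO fI g g' : Site → Dir → ℝ} {c₀ : ℝ} {A : Finset Site}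
    (H : Branches R β α cap x₀ d k fB fO fI) (H' : Sides R β α cap' y₀ d.rev k g g')
    (hy : coord d y₀ < coord d x₀)
    (hα₀ : ∀ i j, Orth i j → 0 ≤ α s(i, j)) (hα : ∀ i j, Orth i j → α s(i, j) ≤ β i)
    (h : α s(d, k) + α s(d, k.rev) ≤ β d ∨ β d.rev ≤ α s(d.rev, k) + α s(d.rev, k.rev))
    (h₁ : c₀ ≤ β d + β d.rev) (h₂ : c₀ ≤ α s(d, k.rev) + β d.rev + β k)
    (h₃ : c₀ ≤ α s(d, k) + α s(d, k.rev) + α s(d.rev, k) + α s(d.rev, k.rev))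
    (hx₀ : x₀ ∈ A) (hy₀ : y₀ ∈ A) (hA : ∀ x ∈ A, x ∉ boundary R) :
    ∃ θ, IsFlow θ A (boundary R) ∧ c₀ ≤ strength θ A ∧ ∀ x c, θ x c ≤ max (cap x c) (cap' x c) := by
  have ho := H.orth
  have hkd := hα k d ho.symm
  rw [Sym2.eq_swap] at hkd
  have hkd' := hα k d.rev ho.symm.rev_right
  rw [Sym2.eq_swap] at hkd'
  obtain ⟨b, o, i, s, s', hb, ho', hi, hs, hs', w1, w2, w3, w4, w5, w6, w7, w8⟩ :=
    exists_weights (hα₀ _ _ ho) (hα₀ _ _ ho.rev_right) (hα₀ _ _ ho.rev_left.rev_right)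
      (hα₀ _ _ ho.rev_left) (hα _ _ ho.rev_right) (hα _ _ ho.rev_left.rev_right) hkd h h₁ h₂ h₃
  obtain ⟨FB, SB⟩ := H.pathB.isFlow hx₀ hA
  obtain ⟨FO, SO⟩ := H.pathO.isFlow hx₀ hA
  obtain ⟨FI, SI⟩ := H.pathI.isFlow hx₀ hA
  obtain ⟨Fg, Sg⟩ := H'.left.isFlow hy₀ hA
  obtain ⟨Fg', Sg'⟩ := H'.right.isFlow hy₀ hA
  refine ⟨_, ((((FB.mul hb).add (FO.mul ho')).add (FI.mul hi)).add (Fg.mul hs)).add (Fg'.mul hs'),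
    ?_, ?_⟩
  · simp only [strength_add, strength_mul, SB, SO, SI, Sg, Sg']
    linarith
  intro x c
  have hT := H.le_capacity hb ho' hi w1 w2 (by linarith) w5 w6 x c
  have hS := H'.le_capacity s s' hs hs' (by linarith) w4 w7 x c
  by_cases hu : coord d x₀ ≤ coord d x
  · have e1 : g x c = 0 := H'.left.eq_zero (by simp only [coord_rev]; omega)
    have e2 : g' x c = 0 := H'.right.eq_zero (by simp only [coord_rev]; omega)
    rw [e1, e2]
    exact le_max_of_le_left (by linarith)
  have e1 : fB x c = 0 := H.pathB.eq_zero (by omega)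
  have e2 : fO x c = 0 := H.pathO.eq_zero (by omega)
  by_cases hI : fI x c = 0
  · rw [e1, e2, hI]
    exact le_max_of_le_right (by linarith)
  have hw : 1 ≤ coord k x := by
    by_contra hw
    exact hI (H.pathI.eq_zero (by omega))
  have e3 : g' x c = 0 := H'.right.eq_zero (by omega)
  have hcap : α s(d.rev, k) ≤ cap x c := by
    rcases H.capacity x c with h | h | h | h | h | h
    · exact absurd h.2.2 hI
    · exact absurd h.1 hu
    · exact hkd'.trans h.2
    · exact absurd h.2.1 hI
    · exact absurd h.2.1 hI
    · exact h.2.2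
  have h3 := H.pathI.mul_le hi x c
  have h4 := H'.left.mul_le hs x c
  rw [e1, e2, e3]
  exact le_max_of_le_left (by linarith)

theorem exists_flow {R : ℕ} (hR : 2 ≤ R) (ω : Env) (j : Dir) {β : Dir → ℝ} {α : Sym2 Dir → ℝ}
    (hα₀ : ∀ i j, Orth i j → 0 ≤ α s(i, j)) (hα : ∀ i j, Orth i j → α s(i, j) ≤ β i) {c₀ : ℝ}
    (h₁ : ∀ d, c₀ ≤ β d + β d.rev)
    (h₂ : ∀ d k, Orth d k → c₀ ≤ α s(d, k) + β d.rev + β k.rev)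
    (h₃ : ∀ d k, Orth d k →
      c₀ ≤ α s(d, k) + α s(d, k.rev) + α s(d.rev, k) + α s(d.rev, k.rev)) :
    ∃ θ, IsFlow θ {0, step j} (boundary R) ∧ c₀ ≤ strength θ {0, step j} ∧
      ∀ x c, θ x c ≤ capacity β α R ω j x c := by
  have c0 : ∀ k, coord k 0 = 0 := fun k => by simp [coord]
  obtain ⟨k₁, _, _, _, T₁⟩ := exists_treeData hR ω 0 j.rev (fun k _ => c0 k)
    (by rw [c0]; omega) (by rw [c0]; omega)
  obtain ⟨k₂, _, _, _, T₂⟩ := exists_treeData hR ω (step j) j (fun k hk => hk.symm.coord_step)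
    (by rw [coord_step_self]; omega) (by rw [coord_step_self])
  obtain ⟨_, _, _, B₁⟩ := T₁.exists_branches hα₀ hα
  obtain ⟨_, _, _, B₂⟩ := T₂.exists_branches hα₀ hα
  have hA : ∀ x ∈ ({0, step j} : Finset Site), x ∉ boundary R := by
    have hR' : ((R : ℤ)).natAbs = R := rfl
    intro x hx
    simp only [Finset.mem_insert, Finset.mem_singleton] at hx
    rcases hx with rfl | rfl
    · simp [boundary]; omega
    · fin_cases j <;> simp [boundary, step] <;> omega
  have hset : ((({0, step j} : Finset Site)) : Set Site) = {0, step j} := by push_cast; rfl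
  rw [← hset]
  unfold capacity
  -- This decides which tree contributes its third path. If both alternatives fail, exchanging the
  -- trees turns the failure of the second into the first one; the stems agree up to sign, and the
  -- sum over both sides ignores the sign.
  by_cases hcase : α s(j, k₂) + α s(j, k₂.rev) ≤ β j ∨
      β j.rev ≤ α s(j.rev, k₂) + α s(j.rev, k₂.rev)
  · obtain ⟨g, g', S⟩ := B₁.exists_sides hα₀ hα B₂.orth.rev_left
    obtain ⟨θ, F, hs, hle⟩ := B₂.exists_flow S (by rw [c0, coord_step_self]; omega) hα₀ hα hcase
      (h₁ j) (by simpa using h₂ j k₂.rev B₂.orth.rev_right) (h₃ j k₂ B₂.orth) (by simp) (by simp) hA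
    exact ⟨θ, F, hs, fun x c => max_comm (componentCapacity β α ω _ x c) _ ▸ hle x c⟩
  · have ho₁ := B₁.orth
    obtain ⟨g, g', S⟩ := B₂.exists_sides hα₀ hα (l := k₁) (by simpa using ho₁.rev_left)
    have hcase' : α s(j.rev, k₁) + α s(j.rev, k₁.rev) ≤ β j.rev := by
      push Not at hcase
      rcases B₂.orth.eq_or_eq_rev (l := k₁) (by simpa using ho₁.rev_left) with rfl | rfl
      · exact hcase.2.le
      · rw [Fin.rev_rev, add_comm]; exact hcase.2.le
    have S' : Sides R β α (componentCapacity β α ω (component R ω (step j) j)) (step j) j.rev.rev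
        k₁ g g' := by
      rw [Fin.rev_rev]; exact S
    exact B₁.exists_flow S' (by rw [c0, coord_rev, coord_step_self]; omega) hα₀ hα
      (Or.inl hcase') (h₁ _) (by simpa using h₂ _ k₁.rev ho₁.rev_right) (h₃ _ k₁ ho₁) (by simp)
      (by simp) hA

/-! ### Measurability -/

/-- The function takes countably many values, each of them on a measurable set. -/
structure CountablyMeasurable {Ω X : Type*} [MeasurableSpace Ω] (f : Ω → X) : Prop where
  countable : (Set.range f).Countable
  fiber : ∀ y, MeasurableSet {ω | f ω = y}

namespace CountablyMeasurable

variable {Ω X Y : Type*} [MeasurableSpace Ω]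

theorem const (y : X) : CountablyMeasurable fun _ : Ω => y where
  countable := (Set.countable_singleton y).mono (by rintro _ ⟨_, rfl⟩; rfl)
  fiber z := MeasurableSet.const _

/-- A fibre splits into countably many pieces according to the value of `f`. No σ-algebra on `X` or
`Y` is needed, so exploration states can be intermediate values. -/
theorem bind {f : Ω → X} {g : Ω → X → Y} (hf : CountablyMeasurable f)
    (hg : ∀ s, CountablyMeasurable fun ω => g ω s) : CountablyMeasurable fun ω => g ω (f ω) where
  countable := by
    refine (hf.countable.biUnion fun s _ => (hg s).countable).mono ?_
    rintro _ ⟨ω, rfl⟩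
    exact Set.mem_biUnion ⟨ω, rfl⟩ ⟨ω, rfl⟩
  fiber y := by
    have : {ω | g ω (f ω) = y} = ⋃ s ∈ Set.range f, {ω | f ω = s} ∩ {ω | g ω s = y} := by
      ext ω
      simp only [Set.mem_ofPred_eq, Set.mem_iUnion, Set.mem_inter_iff, Set.mem_range, exists_prop]
      constructor
      · intro h; exact ⟨f ω, ⟨ω, rfl⟩, rfl, h⟩
      · rintro ⟨_, -, rfl, h⟩; exact h
    rw [this]
    exact MeasurableSet.biUnion hf.countable fun s _ => (hf.fiber s).inter ((hg s).fiber y)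

theorem comp {f : Ω → X} (hf : CountablyMeasurable f) (g : X → Y) :
    CountablyMeasurable fun ω => g (f ω) :=
  hf.bind fun s => const (g s)

theorem of_factor {f : Ω → X} {g : Ω → Y} (hf : CountablyMeasurable f)
    (h : ∀ ω ω', f ω = f ω' → g ω = g ω') : CountablyMeasurable g := by
  classical
  rcases isEmpty_or_nonempty Ω with hΩ | ⟨⟨ω₀⟩⟩
  · exact ⟨by rw [Set.range_eq_empty]; exact Set.countable_empty,
      fun y => by rw [Set.eq_empty_of_isEmpty {ω | g ω = y}]; exact MeasurableSet.empty⟩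
  · have : g = fun ω => (fun s => if hs : ∃ ω', f ω' = s then g hs.choose else g ω₀) (f ω) := by
      funext ω
      have hs : ∃ ω', f ω' = f ω := ⟨ω, rfl⟩
      simp only [dif_pos hs]
      exact h _ _ hs.choose_spec.symm
    rw [this]
    exact hf.comp fun s => if hs : ∃ ω', f ω' = s then g hs.choose else g ω₀

theorem pi {ι : Type*} [Finite ι] {f : Ω → ι → X} [Finite X]
    (hf : ∀ i, CountablyMeasurable fun ω => f ω i) : CountablyMeasurable f where
  countable := Set.to_countable _
  fiber y := by
    simp only [funext_iff, Set.ofPred_forall]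
    exact MeasurableSet.iInter fun i => (hf i).fiber (y i)

theorem measurable [MeasurableSpace X] {f : Ω → X} (hf : CountablyMeasurable f) :
    Measurable f := by
  intro s _
  have : f ⁻¹' s = ⋃ y ∈ Set.range f ∩ s, {ω | f ω = y} := by
    ext ω
    simp only [Set.mem_preimage, Set.mem_iUnion, Set.mem_ofPred_eq, exists_prop]
    constructor
    · intro h; exact ⟨f ω, ⟨⟨ω, rfl⟩, h⟩, rfl⟩
    · rintro ⟨_, ⟨-, h⟩, rfl⟩; exact h
  rw [this]
  exact MeasurableSet.biUnion (hf.countable.mono Set.inter_subset_left) fun y _ => hf.fiber y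

end CountablyMeasurable

/-! ### Dependence on the environment through comparisons -/

/-- The comparisons between the transition probabilities at a site. -/
def comparisons (p : Dir → ℝ) : Dir → Dir → Prop := fun k l => p k ≤ p l

theorem countablyMeasurable_comparisons (x : Site) :
    CountablyMeasurable fun ω : Env => comparisons (ω x) := by
  refine CountablyMeasurable.pi fun k => CountablyMeasurable.pi fun l => ⟨Set.to_countable _, ?_⟩
  intro P
  have hm : ∀ k, Measurable fun ω : Env => ω x k := fun k =>
    (measurable_pi_apply k).comp (measurable_subtype_coe.comp (measurable_pi_apply x))
  have hset : MeasurableSet {ω : Env | ω x k ≤ ω x l} := measurableSet_le (hm k) (hm l)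
  by_cases hP : P
  · simp only [comparisons, hP, eq_iff_iff, iff_true]
    exact hset
  · simp only [comparisons, hP, eq_iff_iff, iff_false]
    exact hset.compl

section comparisons

variable {p q : Dir → ℝ}

theorem best_congr (h : comparisons p = comparisons q) (S : Finset Dir) : best p S = best q S := by
  have h' : ∀ k l, (p k ≤ p l) = (q k ≤ q l) := fun k l => congrFun₂ h k l
  unfold best
  congr 2
  exact Finset.filter_congr fun k _ => by simp only [h']

theorem canForward_congr (h : comparisons p = comparisons q) (j : Dir) :
    CanForward p j ↔ CanForward q j := by
  have h' : ∀ k l, (p k ≤ p l) = (q k ≤ q l) := fun k l => congrFun₂ h k l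
  simp only [CanForward, h']

theorem bif₁_congr (h : comparisons p = comparisons q) (j : Dir) : bif₁ p j = bif₁ q j :=
  best_congr h _

theorem bif₂_congr (h : comparisons p = comparisons q) (j : Dir) : bif₂ p j = bif₂ q j := by
  rw [bif₂, bif₂, bif₁_congr h, best_congr h]

theorem activate_congr (h : comparisons p = comparisons q) (b : ℕ) (I : Instruction) :
    activate p b I = activate q b I := by
  classical cases I <;> simp only [activate, canForward_congr h, bif₁_congr h, bif₂_congr h, best_congr h]

theorem bifCount_congr (h : comparisons p = comparisons q) (I : Instruction) :
    bifCount p I = bifCount q I := by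
  classical cases I <;> simp only [bifCount, canForward_congr h]

theorem edgeCapacity_congr (h : comparisons p = comparisons q) (β : Dir → ℝ) (α : Sym2 Dir → ℝ)
    (k : Dir) (I : Instruction) : edgeCapacity β α p k I = edgeCapacity β α q k I := by
  classical cases I <;> simp only [edgeCapacity, canForward_congr h, bif₁_congr h]

end comparisons

/-- From a fixed state, an update reads the environment at one site, and only through comparisons.
-/
theorem countablyMeasurable_update (R : ℕ) (s : State) :
    CountablyMeasurable fun ω : Env => update R ω s := by
  by_cases h : s.active.Nonempty
  · refine (countablyMeasurable_comparisons (lexMin s.active h)).of_factor fun ω ω' hω => ?_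
    simp only [update, dif_pos h, activate_congr hω, bifCount_congr hω]
  · simp only [update, dif_neg h]
    exact CountablyMeasurable.const s

theorem countablyMeasurable_explore (R : ℕ) (x₀ : Site) (j : Dir) (t : ℕ) :
    CountablyMeasurable fun ω : Env => explore R ω x₀ j t := by
  induction t with
  | zero => exact CountablyMeasurable.const _
  | succ t ih =>
    simp only [explore, Function.iterate_succ_apply'] at ih ⊢
    exact ih.bind fun s => countablyMeasurable_update R s

theorem countablyMeasurable_stopTime (R : ℕ) (x₀ : Site) (j : Dir) :
    CountablyMeasurable fun ω : Env => stopTime R ω x₀ j := by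
  let S : ℕ → Set Env := fun t => {ω | (explore R ω x₀ j t).active = ∅}
  have hT : ∀ t, MeasurableSet (S t) := fun t =>
    ((countablyMeasurable_explore R x₀ j t).comp State.active).fiber ∅
  refine ⟨Set.to_countable _, fun n => ?_⟩
  -- The second set accounts for `sInf ∅ = 0`, so termination need not be invoked here.
  have : {ω : Env | stopTime R ω x₀ j = n} =
      (S n ∩ ⋂ m, ⋂ (_ : m < n), (S m)ᶜ) ∪ ({_ω | n = 0} ∩ ⋂ m, (S m)ᶜ) := by
    ext ω
    simp only [Set.mem_union, Set.mem_inter_iff, Set.mem_iInter, Set.mem_compl_iff]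
    change sInf {t | ω ∈ S t} = n ↔ _ ∨ n = 0 ∧ _
    by_cases hne : {t | ω ∈ S t}.Nonempty
    · constructor
      · rintro rfl
        exact Or.inl ⟨Nat.sInf_mem hne, fun m hm => Nat.notMem_of_lt_sInf hm⟩
      · rintro (⟨h₁, h₂⟩ | ⟨-, h⟩)
        · exact le_antisymm (Nat.sInf_le h₁)
            (not_lt.1 fun hlt => h₂ _ hlt (Nat.sInf_mem hne))
        · exact absurd (Nat.sInf_mem hne) (h _)
    · have hne' : ∀ t, ω ∉ S t := fun t ht => hne ⟨t, ht⟩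
      rw [Set.not_nonempty_iff_eq_empty.1 hne, Nat.sInf_empty]
      constructor
      · intro h
        exact Or.inr ⟨h.symm, hne'⟩
      · rintro (h | h)
        · exact absurd h.1 (hne' n)
        · exact h.1.symm
  rw [this]
  exact ((hT n).inter (.iInter fun m => .iInter fun _ => (hT m).compl)).union
    ((MeasurableSet.const _).inter (.iInter fun m => (hT m).compl))

theorem countablyMeasurable_component (R : ℕ) (x₀ : Site) (j : Dir) :
    CountablyMeasurable fun ω : Env => component R ω x₀ j :=
  (countablyMeasurable_stopTime R x₀ j).bind fun t => countablyMeasurable_explore R x₀ j t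

theorem countablyMeasurable_componentCapacity (β : Dir → ℝ) (α : Sym2 Dir → ℝ) (R : ℕ) (x₀ : Site)
    (j : Dir) : CountablyMeasurable fun (ω : Env) (x : Site) (k : Dir) =>
      componentCapacity β α ω (component R ω x₀ j) x k := by
  refine (countablyMeasurable_component R x₀ j).bind
    (g := fun ω C x k => componentCapacity β α ω C x k) fun C => ?_
  refine (CountablyMeasurable.pi (f := fun (ω : Env) (e : C.edges) => comparisons (ω e.1.1))
    fun e => countablyMeasurable_comparisons e.1.1).of_factor fun ω ω' h => ?_
  funext x k
  by_cases hC : (x, k) ∈ C.edges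
  · rw [componentCapacity, componentCapacity, if_pos hC, if_pos hC]
    exact edgeCapacity_congr (congrFun h ⟨(x, k), hC⟩) β α k _
  · rw [componentCapacity, componentCapacity, if_neg hC, if_neg hC]

theorem countablyMeasurable_capacity (β : Dir → ℝ) (α : Sym2 Dir → ℝ) (R : ℕ) (j : Dir) :
    CountablyMeasurable fun (ω : Env) (x : Site) (k : Dir) => capacity β α R ω j x k :=
  ((countablyMeasurable_componentCapacity β α R 0 j.rev).bind fun c =>
    (countablyMeasurable_componentCapacity β α R (step j) j).comp fun c' => (c, c')).comp
      fun c x k => max (c.1 x k) (c.2 x k)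

theorem exists_uniform_gap {ι : Type*} [Finite ι] {a : ℝ} {f : ι → ℝ} (h : ∀ i, a < f i) :
    ∃ ε, 0 < ε ∧ ∀ i, a + ε ≤ f i := by
  cases isEmpty_or_nonempty ι
  · exact ⟨1, one_pos, fun i => isEmptyElim i⟩
  · obtain ⟨i, hi⟩ := Finite.exists_min f
    exact ⟨f i - a, sub_pos.2 (h i), fun l => by linarith [hi l]⟩

theorem square_eq (α : Sym2 Dir → ℝ) {d k : Dir} (h : Orth d k) :
    α s(d, k) + α s(d, k.rev) + α s(d.rev, k) + α s(d.rev, k.rev) =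
      α s(2, 3) + α s(1, 3) + α s(1, 0) + α s(2, 0) := by
  have e1 : (s(0, 1) : Sym2 Dir) = s(1, 0) := Sym2.eq_swap
  have e2 : (s(0, 2) : Sym2 Dir) = s(2, 0) := Sym2.eq_swap
  have e3 : (s(3, 1) : Sym2 Dir) = s(1, 3) := Sym2.eq_swap
  have e4 : (s(3, 2) : Sym2 Dir) = s(2, 3) := Sym2.eq_swap
  have r0 : (0 : Dir).rev = 3 := rfl
  have r1 : (1 : Dir).rev = 2 := rfl
  have r2 : (2 : Dir).rev = 1 := rfl
  have r3 : (3 : Dir).rev = 0 := rfl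
  obtain ⟨h₁, h₂⟩ := h
  have key : ∀ d k : Dir, k ≠ d → k ≠ d.rev → (d = 0 ∧ k = 1) ∨ (d = 0 ∧ k = 2) ∨ (d = 1 ∧ k = 0) ∨
      (d = 1 ∧ k = 3) ∨ (d = 2 ∧ k = 0) ∨ (d = 2 ∧ k = 3) ∨ (d = 3 ∧ k = 1) ∨ (d = 3 ∧ k = 2) := by
    decide
  rcases key d k h₁ h₂ with ⟨rfl, rfl⟩ | ⟨rfl, rfl⟩ | ⟨rfl, rfl⟩ | ⟨rfl, rfl⟩ | ⟨rfl, rfl⟩ |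
    ⟨rfl, rfl⟩ | ⟨rfl, rfl⟩ | ⟨rfl, rfl⟩ <;> simp only [r0, r1, r2, r3, e1, e2, e3, e4] <;> ring

end RWRE

theorem theorem3p12
    (μ : MeasureTheory.Measure RWRE.Env) [MeasureTheory.IsProbabilityMeasure μ]
    (hiid : RWRE.IsIID μ)
    (a : ℝ) (ha : 0 < a)
    (β : RWRE.Dir → ℝ) (α : Sym2 RWRE.Dir → ℝ)
    (hX : RWRE.ConditionX μ a β α)
    (hα_nonneg : ∀ i j, RWRE.Orth i j → 0 ≤ α s(i, j))
    (hα_le : ∀ i j, RWRE.Orth i j → α s(i, j) ≤ β i)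
    (jstar : RWRE.Env → RWRE.Dir) (hj_meas : Measurable jstar)
    (hj : ∀ (ω : RWRE.Env) (k : RWRE.Dir), ω 0 k ≤ ω 0 (jstar ω))
    (R : ℕ) (hR : 2 ≤ R) :
    ∃ ε : ℝ, 0 < ε ∧ ∃ θ : RWRE.Env → RWRE.Site → RWRE.Dir → ℝ,
      (∀ x k, Measurable fun ω => θ ω x k) ∧
      ∀ᵐ ω ∂μ,
        RWRE.IsFlow (θ ω) {0, RWRE.step (jstar ω)} (RWRE.boundary R) ∧
        a + ε ≤ RWRE.strength (θ ω) {0, RWRE.step (jstar ω)} ∧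
        ∀ x k, θ ω x k ≤ RWRE.capacity β α R ω (jstar ω) x k := by
  classical
  open RWRE in
  obtain ⟨ε₁, hε₁, h₁⟩ := exists_uniform_gap hX.edge
  obtain ⟨ε₂, hε₂, h₂⟩ := exists_uniform_gap (ι := {e : Dir × Dir // Orth e.1 e.2})
    fun e => hX.wedge e.1.1 e.1.2 e.2
  -- The smallest slack among the edge, wedge and square inequalities, independent of the
  -- environment.
  set ε := min (min ε₁ ε₂) (α s(2, 3) + α s(1, 3) + α s(1, 0) + α s(2, 0) - a) with hε
  have hε1 : ε ≤ ε₁ := (min_le_left _ _).trans (min_le_left _ _)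
  have hε2 : ε ≤ ε₂ := (min_le_left _ _).trans (min_le_right _ _)
  have hε3 : ε ≤ α s(2, 3) + α s(1, 3) + α s(1, 0) + α s(2, 0) - a := min_le_right _ _
  have hex : ∀ ω, ∃ θ, IsFlow θ {0, step (jstar ω)} (boundary R) ∧
      a + ε ≤ strength θ {0, step (jstar ω)} ∧
      ∀ x c, θ x c ≤ (fun x k => RWRE.capacity β α R ω (jstar ω) x k) x c := fun ω =>
    exists_flow hR ω (jstar ω) hα_nonneg hα_le (fun d => by linarith [h₁ d])
      (fun d k hdk => by linarith [h₂ ⟨(d, k), hdk⟩])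
      (fun d k hdk => by rw [square_eq α hdk]; linarith)
  have hj' : CountablyMeasurable jstar :=
    ⟨Set.to_countable _, fun y => hj_meas (measurableSet_singleton y)⟩
  have hdata : CountablyMeasurable fun ω =>
      ((jstar ω, fun x k => RWRE.capacity β α R ω (jstar ω) x k) : Dir × (Site → Dir → ℝ)) :=
    hj'.bind (g := fun ω j => (j, fun x k => RWRE.capacity β α R ω j x k)) fun j =>
      (countablyMeasurable_capacity β α R j).comp fun c => (j, c)
  -- Choosing per value of the data, rather than per environment, makes the flow measurable; the
  -- default `0` is never used at data that occur.
  let Φ : Dir × (Site → Dir → ℝ) → Site → Dir → ℝ := fun D =>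
    if h : ∃ θ, IsFlow θ {0, step D.1} (boundary R) ∧ a + ε ≤ strength θ {0, step D.1} ∧
      ∀ x c, θ x c ≤ D.2 x c then h.choose else 0
  refine ⟨ε, lt_min (lt_min hε₁ hε₂) (sub_pos.2 hX.square),
    fun ω => Φ (jstar ω, fun x k => RWRE.capacity β α R ω (jstar ω) x k),
    fun x k => (hdata.comp fun D => Φ D x k).measurable, Filter.Eventually.of_forall fun ω => ?_⟩
  have h := hex ω
  simp only [Φ, dif_pos h]
  exact h.choose_spec
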